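/- Let $M$ be a smooth compact manifold, possibly with boundary or corners, and let $\mu_0$ be a smooth positive density on $M$ with $\int_M\mu_0=1$. Let $C_1,C_2:(0,\infty)\to\mathbb R$ be smooth with $C_1(m)>0$ and $C_2(m)>-\frac1m C_1(m)$ for all $m>0$. Put $$g_2(r)=4\left(C_2(r^2)r^2+C_1(r^2)\right),\qquad W(r)=\int_1^r\sqrt{g_2(\rho)}\,d\rho\qquad(r>0),$$ and assume that $W_-:=\lim_{r\to0+}W(r)=-\infty$ and $W_+:=\lim_{r\to\infty}W(r)=+\infty$. Let $s\mapsto r(s)$ be the inverse of the diffeomorphism $W:(0,\infty)\to\mathbb R$ and let $a(s)=4\,C_1(r(s)^2)\,r(s)^2$. Let $S=\{\varphi\in L^2(M,\mu_0;\mathbb R):\int_M\varphi^2\mu_0=1\}$, and equip $\mathbb R\times S$ with the Riemannian metric $$\bar G_{s,\varphi}=ds^2+a(s)\,\langle d\varphi,d\varphi\rangle_{L^2(\mu_0)} .$$ A geodesic is a smooth curve defined on an open interval, whose energy $\frac12\int_{t_0}^{t_1}\bar G(\dot c,\dot c)\,dt$ is stationary under smooth variations with fixed end points, for all $t_0<t_1$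 in the interval. A space is called geodesically complete if every tangent vector is the initial velocity of a geodesic defined on all of $\mathbb R$ and every geodesic extends to a geodesic defined on all of $\mathbb R$. The geodesic distance of two points of $\mathbb R\times S$ is the infimum of the $\bar G$-lengths of the $C^1$ curves in $\mathbb R\times S$ joining them (it takes the value $\infty$ only if $M$ is a single point, when $S$ is disconnected). Then: 1. The geodesic distance of $\bar G$ is a metric on $\mathbb R\times S$, and $\mathbb R\times S$ is complete for this metric. 2. $(\mathbb R\times S,\bar G)$ is geodesically complete. 3. $(\mathbb R\times (S\cap C^\infty(M,\mathbb R)),\bar G)$ is geodesically complete. Here curves and variations are taken in $\mathbb R\times(S\cap C^\infty(M,\mathbb R))$, are smooth for the Fréchet topology of $C^\infty(M,\mathbb R)$ (equivalently, are jointly smooth functions of the parameters and of $x\in M$), and initial velocities are in $\mathbb R\times C^\infty(M,\mathbb R)$ and tangent to $\mathbb R\times S$. -/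

import Mathlib

open Set MeasureTheory Filter Topology
open scoped ENNReal Manifold ContDiff

noncomputable section

namespace FisherRao

/-! ### The radial reparametrisation and the warping function -/

/-- The radial coefficient `g₂(r) = 4 (C₂(r²) r² + C₁(r²))` of the metric in polar coordinates. -/
def g₂ (C₁ C₂ : ℝ → ℝ) (r : ℝ) : ℝ := 4 * (C₂ (r ^ 2) * r ^ 2 + C₁ (r ^ 2))

/-- The new radial coordinate `s = W(r) = ∫₁^r √(g₂(ρ)) dρ`, for `r > 0`. -/
def W (C₁ C₂ : ℝ → ℝ) (r : ℝ) : ℝ := ∫ ρ in (1 : ℝ)..r, Real.sqrt (g₂ C₁ C₂ ρ)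

/-- The inverse function `s ↦ r(s) > 0` of `W : (0, ∞) → (W₋, W₊)`. -/
def radius (C₁ C₂ : ℝ → ℝ) (s : ℝ) : ℝ := Function.invFunOn (W C₁ C₂) (Ioi 0) s

/-- The warping function `a(s) = 4 C₁(r(s)²) r(s)²`. -/
def warp (C₁ C₂ : ℝ → ℝ) (s : ℝ) : ℝ :=
  4 * C₁ (radius C₁ C₂ s ^ 2) * radius C₁ C₂ s ^ 2

/-! ### The warped cylinder over the unit sphere of a (pre-)Hilbert space

The sphere `S` is a submanifold of `H`, so smooth maps into `ℝ × S` are smooth maps into `ℝ × H`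
with values in `ℝ × S`, and the tangent space of `S` at `φ` is the orthogonal complement of `φ`. -/

section Cylinder

variable {H : Type*} [NormedAddCommGroup H] [InnerProductSpace ℝ H]

/-- The set `ℝ × S` inside `ℝ × H`, with `S` the unit sphere of `H`. -/
def cylinder (H : Type*) [NormedAddCommGroup H] : Set (ℝ × H) :=
  univ ×ˢ Metric.sphere (0 : H) 1

/-- The metric `ds² + a(s) ⟨dφ, dφ⟩` at the point `p = (s, φ)`. -/
def metric (a : ℝ → ℝ) (p v w : ℝ × H) : ℝ := v.1 * w.1 + a p.1 * inner ℝ v.2 w.2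

/-- The length of a curve `γ : [0, 1] → ℝ × S`. -/
def length (a : ℝ → ℝ) (γ : ℝ → ℝ × H) : ℝ≥0∞ :=
  ∫⁻ t in Icc (0 : ℝ) 1, ENNReal.ofReal (Real.sqrt
    (metric a (γ t) (derivWithin γ (Icc 0 1) t) (derivWithin γ (Icc 0 1) t)))

/-- The geodesic distance on `ℝ × S`: the infimum of the lengths of the `C¹` curves in `ℝ × S` from
`x` to `y` (it is `∞` if there is no such curve). -/
def geodesicDist (a : ℝ → ℝ) (x y : ℝ × Metric.sphere (0 : H) 1) : ℝ≥0∞ :=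
  ⨅ (γ : ℝ → ℝ × H) (_ : ContDiffOn ℝ 1 γ (Icc 0 1)) (_ : ∀ t ∈ Icc (0 : ℝ) 1, γ t ∈ cylinder H)
    (_ : γ 0 = (x.1, (x.2 : H))) (_ : γ 1 = (y.1, (y.2 : H))), length a γ

/-- The energy on `[t₀, t₁]` of a curve in `ℝ × S`. -/
def energy (a : ℝ → ℝ) (t₀ t₁ : ℝ) (c : ℝ → ℝ × H) : ℝ :=
  ∫ t in t₀..t₁, (1 / 2 : ℝ) * metric a (c t) (deriv c t) (deriv c t)

/-- A linear subspace of `H` (its underlying set `points`) together with the notion of smooth map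
`P ⊇ U → points` for open `U` in a normed space `P`. Only `fullSpace` and `smoothFunctions` below
are used. -/
structure SmoothSpace (H : Type*) where
  points : Set H
  IsSmooth : ∀ {P : Type} [NormedAddCommGroup P] [NormedSpace ℝ P], Set P → (P → H) → Prop

/-- `f : P → ℝ × H` maps the open set `U` smoothly into `ℝ × (S ∩ X)`. -/
def SmoothInto (X : SmoothSpace H) {P : Type} [NormedAddCommGroup P] [NormedSpace ℝ P]
    (U : Set P) (f : P → ℝ × H) : Prop :=
  ContDiffOn ℝ ∞ (fun p => (f p).1) U ∧ X.IsSmooth U (fun p => (f p).2) ∧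
    ∀ p ∈ U, f p ∈ cylinder H ∧ (f p).2 ∈ X.points

/-- `c` is a geodesic of `ds² + a(s) ⟨dφ, dφ⟩` in `ℝ × (S ∩ X)`, defined on the open interval `J`: a
smooth curve such that, on each compact interval `[t₀, t₁] ⊆ J`, the derivative of the energy
vanishes along each smooth variation of `c` in `ℝ × (S ∩ X)` with fixed end points. -/
def IsGeodesicOn (a : ℝ → ℝ) (X : SmoothSpace H) (J : Set ℝ) (c : ℝ → ℝ × H) : Prop :=
  SmoothInto X J c ∧
  ∀ t₀ t₁ : ℝ, t₀ < t₁ → Icc t₀ t₁ ⊆ J →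
    ∀ δ > 0, ∀ F : ℝ × ℝ → ℝ × H,
      SmoothInto X (Ioo (-δ) δ ×ˢ J) F →
      (∀ t ∈ J, F (0, t) = c t) →
      (∀ ε ∈ Ioo (-δ) δ, F (ε, t₀) = c t₀ ∧ F (ε, t₁) = c t₁) →
      HasDerivAt (fun ε => energy a t₀ t₁ (fun t => F (ε, t))) 0 0

/-- Geodesic completeness of `ℝ × (S ∩ X)` with the metric `ds² + a(s) ⟨dφ, dφ⟩`: each tangent
vector is the initial velocity of a geodesic defined on all of `ℝ`, and each geodesic on an open
interval extends to a geodesic defined on all of `ℝ`. -/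
def IsGeodesicallyComplete (a : ℝ → ℝ) (X : SmoothSpace H) : Prop :=
  (∀ p v : ℝ × H, p ∈ cylinder H → p.2 ∈ X.points → v.2 ∈ X.points → inner ℝ p.2 v.2 = 0 →
    ∃ c : ℝ → ℝ × H, IsGeodesicOn a X univ c ∧ c 0 = p ∧ deriv c 0 = v) ∧
  (∀ (J : Set ℝ) (c : ℝ → ℝ × H), IsOpen J → J.OrdConnected → J.Nonempty → IsGeodesicOn a X J c →
    ∃ c' : ℝ → ℝ × H, IsGeodesicOn a X univ c' ∧ EqOn c' c J)

/-- The whole Hilbert space `H`, with the usual smooth maps. -/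
def fullSpace (H : Type*) [NormedAddCommGroup H] [InnerProductSpace ℝ H] : SmoothSpace H where
  points := univ
  IsSmooth U f := ContDiffOn ℝ ∞ f U

end Cylinder

/-- `d` is an (extended) metric on `X`, and `X` is complete for it. -/
def IsMetricallyComplete {X : Type*} (d : X → X → ℝ≥0∞) : Prop :=
  ∃ e : EMetricSpace X, (∀ x y, e.edist x y = d x y) ∧ @CompleteSpace X e.toUniformSpace

/-! ### Smooth densities and smooth functions on a compact manifold with corners -/

section Manifold

variable {m : ℕ} {B : Type*} [TopologicalSpace B]
  (I : ModelWithCorners ℝ (EuclideanSpace ℝ (Fin m)) B)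
  {M : Type*} [TopologicalSpace M] [ChartedSpace B M] [MeasurableSpace M]

/-- `μ` is (the measure given by) a smooth positive density on `M`: in the charts it is a smooth
positive function times Lebesgue measure. -/
def IsSmoothPositiveDensity (μ : Measure M) : Prop :=
  ∀ x : M, ∃ ρ : EuclideanSpace ℝ (Fin m) → ℝ,
    ContDiffOn ℝ ∞ ρ (extChartAt I x).target ∧ (∀ y ∈ (extChartAt I x).target, 0 < ρ y) ∧
    (μ.restrict (extChartAt I x).source).map (extChartAt I x) =
      (volume.restrict (extChartAt I x).target).withDensity (fun y => ENNReal.ofReal (ρ y))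

/-- The subspace `C^∞(M, ℝ)` of `L²(M, μ)`. A map `p ↦ f p` from an open set `U` into the Fréchet
space `C^∞(M, ℝ)`, with `M` compact, is smooth iff the function `(p, x) ↦ f p x` is smooth on
`U × M`; it is then also smooth as a map into `L²(M, μ)`. -/
def smoothFunctions (μ : Measure M) : SmoothSpace (Lp ℝ 2 μ) where
  points := {f | ∃ u : M → ℝ, ContMDiff I 𝓘(ℝ, ℝ) ∞ u ∧ f =ᵐ[μ] u}
  IsSmooth {P} _ _ U f := ContDiffOn ℝ ∞ f U ∧
    ∃ u : P → M → ℝ,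
      ContMDiffOn (𝓘(ℝ, P).prod I) 𝓘(ℝ, ℝ) ∞ (fun q : P × M => u q.1 q.2) (U ×ˢ univ) ∧
      ∀ p ∈ U, f p =ᵐ[μ] u p

end Manifold

end FisherRao

end

/-!
The substitution `s = W(r)` turns the problem into one about the warped product metric
`ds² + a(s) ⟨dφ, dφ⟩` on `ℝ × S`. The hypotheses on `W₋` and `W₊` say that `W : (0, ∞) → ℝ` is
onto, so its inverse, and with it the warping function `a`, is smooth and positive on the whole line
(`contDiff_warp`, `warp_pos`). All completeness statements hold for every such `a`.

*Metric completeness* (`isMetricallyComplete_geodesicDist`). The length of a curve bounds the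
change of `s`. So a Cauchy sequence stays where `a` lies between positive constants; there the
geodesic distance is comparable with the distance of `ℝ × H`, in which `ℝ × S` is closed. The
triangle inequality needs `C¹` concatenations, for which the curves are reparametrised so that
they stop smoothly at their end points.

*Geodesics* (`isGeodesicOn_iff`). The first variation formula (`hasDerivAt_energy`) expresses the
derivative of the energy by the residual of the geodesic equation `s'' = ½ a'(s) |φ'|²`,
`(a(s) φ')' = -a(s) |φ'|² φ`. The residual of a smooth curve in `ℝ × S` is itself tangent to `S`
and, for curves of smooth functions, again a smooth curve of smooth functions. Hence it is an
admissible direction of variation, and stationarity in this direction makes it vanish. This treats `S` and `S ∩ C^∞(M)`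
alike, with no recourse to the density of the smooth functions in `L²`; the few properties of the
space that are used are collected in `SmoothSpace.IsRegular`.

*Geodesic completeness* (`isGeodesicallyComplete`). The component `φ` of a geodesic moves in the
plane of `φ(t₀)` and `φ'(t₀)`, on a great circle, with constant angular momentum `K = a(s) |φ'|`,
and `s` solves Newton's equation with the nonnegative potential `K² / (2 a(s))`. Conservation of
energy bounds the speed of `s`, so this equation has global solutions (`exists_newton_solution`),
and the great circle stays in the space spanned by the initial data, so it is a smooth curve of
smooth functions if these are smooth (`exists_geodesic`). A geodesic on an interval extends since
it agrees there with the global geodesic with the same position and velocity at one time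
(`eqOn_of_residual_eq_zero`).

For `C^∞(M)`, it has to be known that the time derivative of a smooth curve is again one: the
derivative in `L²` is represented by the pointwise derivative (`ae_eq_deriv_of_hasDerivAt_Lp`),
which is jointly smooth (`contMDiffOn_deriv_fst`).
-/

noncomputable section

namespace FisherRao

/-! ### The warping function -/

/-- Bootstrapping: a solution of an autonomous ordinary differential equation is as smooth as the
vector field. -/
theorem contDiff_of_hasDerivAt_comp {E : Type*} [NormedAddCommGroup E] [NormedSpace ℝ E]
    {v : E → E} {U : Set E} (hv : ContDiffOn ℝ ∞ v U) {γ : ℝ → E} (hU : ∀ t, γ t ∈ U)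
    (hγ : ∀ t, HasDerivAt γ (v (γ t)) t) : ContDiff ℝ ∞ γ := by
  rw [contDiff_infty]
  intro n
  induction n with
  | zero =>
    exact contDiff_zero.2 (continuous_iff_continuousAt.2 fun t => (hγ t).continuousAt)
  | succ n ih =>
    have hd : deriv γ = v ∘ γ := funext fun t => (hγ t).deriv
    rw [show ((n + 1 : ℕ) : WithTop ℕ∞) = (n : WithTop ℕ∞) + 1 by norm_cast,
      contDiff_succ_iff_deriv]
    refine ⟨fun t => (hγ t).differentiableAt, by simp, ?_⟩
    rw [hd, ← contDiffOn_univ]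
    exact ((hv.of_le (by exact_mod_cast le_top)).comp (contDiffOn_univ.2 ih) fun t _ => hU t)

section Warp

variable {C₁ C₂ : ℝ → ℝ}

theorem contDiffOn_g₂ (hC₁ : ContDiffOn ℝ ∞ C₁ (Ioi 0)) (hC₂ : ContDiffOn ℝ ∞ C₂ (Ioi 0)) :
    ContDiffOn ℝ ∞ (g₂ C₁ C₂) (Ioi 0) := by
  have hsq : ContDiffOn ℝ ∞ (fun r : ℝ => r ^ 2) (Ioi 0) := (contDiff_id.pow 2).contDiffOn
  have hmaps : MapsTo (fun r : ℝ => r ^ 2) (Ioi 0) (Ioi 0) := fun r hr => by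
    have : (0 : ℝ) < r := hr
    exact pow_pos this 2
  exact contDiffOn_const.mul (((hC₂.comp hsq hmaps).mul hsq).add (hC₁.comp hsq hmaps))

theorem g₂_pos (hpos₂ : ∀ x > 0, -(1 / x) * C₁ x < C₂ x) {r : ℝ} (hr : 0 < r) :
    0 < g₂ C₁ C₂ r := by
  have h2 : 0 < r ^ 2 := pow_pos hr 2
  have h := mul_lt_mul_of_pos_right (hpos₂ (r ^ 2) h2) h2
  have h' : -(1 / r ^ 2) * C₁ (r ^ 2) * r ^ 2 = -C₁ (r ^ 2) := by field_simp
  rw [h'] at h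
  unfold g₂
  linarith

theorem contDiffOn_sqrt_g₂ (hC₁ : ContDiffOn ℝ ∞ C₁ (Ioi 0)) (hC₂ : ContDiffOn ℝ ∞ C₂ (Ioi 0))
    (hpos₂ : ∀ x > 0, -(1 / x) * C₁ x < C₂ x) :
    ContDiffOn ℝ ∞ (fun r => Real.sqrt (g₂ C₁ C₂ r)) (Ioi 0) :=
  (contDiffOn_g₂ hC₁ hC₂).sqrt fun _ hr => (g₂_pos hpos₂ hr).ne'

theorem hasDerivAt_W (hC₁ : ContDiffOn ℝ ∞ C₁ (Ioi 0)) (hC₂ : ContDiffOn ℝ ∞ C₂ (Ioi 0))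
    (hpos₂ : ∀ x > 0, -(1 / x) * C₁ x < C₂ x) {r : ℝ} (hr : 0 < r) :
    HasDerivAt (W C₁ C₂) (Real.sqrt (g₂ C₁ C₂ r)) r := by
  have hc := (contDiffOn_sqrt_g₂ hC₁ hC₂ hpos₂).continuousOn
  have hsub : uIcc 1 r ⊆ Ioi 0 := fun x hx => lt_of_lt_of_le (lt_min one_pos hr) hx.1
  exact intervalIntegral.integral_hasDerivAt_right ((hc.mono hsub).intervalIntegrable)
    (hc.stronglyMeasurableAtFilter isOpen_Ioi r hr) (hc.continuousAt (Ioi_mem_nhds hr))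

theorem strictMonoOn_W (hC₁ : ContDiffOn ℝ ∞ C₁ (Ioi 0)) (hC₂ : ContDiffOn ℝ ∞ C₂ (Ioi 0))
    (hpos₂ : ∀ x > 0, -(1 / x) * C₁ x < C₂ x) : StrictMonoOn (W C₁ C₂) (Ioi 0) := by
  refine strictMonoOn_of_deriv_pos (convex_Ioi 0)
    (fun r hr => (hasDerivAt_W hC₁ hC₂ hpos₂ hr).continuousAt.continuousWithinAt) fun r hr => ?_
  rw [interior_Ioi] at hr
  rw [(hasDerivAt_W hC₁ hC₂ hpos₂ hr).deriv]
  exact Real.sqrt_pos.2 (g₂_pos hpos₂ hr)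

theorem surjOn_W (hC₁ : ContDiffOn ℝ ∞ C₁ (Ioi 0)) (hC₂ : ContDiffOn ℝ ∞ C₂ (Ioi 0))
    (hpos₂ : ∀ x > 0, -(1 / x) * C₁ x < C₂ x)
    (hW_minus : Tendsto (W C₁ C₂) (𝓝[>] 0) atBot) (hW_plus : Tendsto (W C₁ C₂) atTop atTop) :
    SurjOn (W C₁ C₂) (Ioi 0) univ := by
  intro s _
  have h1 : ∃ r, 0 < r ∧ W C₁ C₂ r ≤ s :=
    (((hW_minus.eventually (eventually_le_atBot s)).and self_mem_nhdsWithin).exists).imp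
      fun r hr => ⟨hr.2, hr.1⟩
  have h2 : ∃ r, 0 < r ∧ s ≤ W C₁ C₂ r :=
    (((hW_plus.eventually (eventually_ge_atTop s)).and (eventually_gt_atTop 0)).exists).imp
      fun r hr => ⟨hr.2, hr.1⟩
  obtain ⟨r₁, hr₁, h1⟩ := h1
  obtain ⟨r₂, hr₂, h2⟩ := h2
  exact isPreconnected_Ioi.intermediate_value (s := Ioi (0 : ℝ)) hr₁ hr₂
    (fun r hr => (hasDerivAt_W hC₁ hC₂ hpos₂ hr).continuousAt.continuousWithinAt) ⟨h1, h2⟩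

theorem radius_pos (hsurj : SurjOn (W C₁ C₂) (Ioi 0) univ) (s : ℝ) : 0 < radius C₁ C₂ s :=
  Function.invFunOn_mem (hsurj (mem_univ s))

theorem W_radius (hsurj : SurjOn (W C₁ C₂) (Ioi 0) univ) (s : ℝ) : W C₁ C₂ (radius C₁ C₂ s) = s :=
  Function.invFunOn_eq (hsurj (mem_univ s))

theorem radius_W (hmono : StrictMonoOn (W C₁ C₂) (Ioi 0)) {r : ℝ} (hr : 0 < r) :
    radius C₁ C₂ (W C₁ C₂ r) = r :=
  hmono.injOn.leftInvOn_invFunOn hr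

theorem contDiff_radius (hC₁ : ContDiffOn ℝ ∞ C₁ (Ioi 0)) (hC₂ : ContDiffOn ℝ ∞ C₂ (Ioi 0))
    (hpos₂ : ∀ x > 0, -(1 / x) * C₁ x < C₂ x) (hsurj : SurjOn (W C₁ C₂) (Ioi 0) univ) :
    ContDiff ℝ ∞ (radius C₁ C₂) := by
  have hmono := strictMonoOn_W hC₁ hC₂ hpos₂
  have hrmono : StrictMono (radius C₁ C₂) := fun s t hst => by
    rw [← hmono.lt_iff_lt (radius_pos hsurj s) (radius_pos hsurj t), W_radius hsurj,
      W_radius hsurj]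
    exact hst
  have himage : radius C₁ C₂ '' univ = Ioi 0 := by
    ext r
    constructor
    · rintro ⟨s, _, rfl⟩
      exact radius_pos hsurj s
    · exact fun hr => ⟨W C₁ C₂ r, mem_univ _, radius_W hmono hr⟩
  have hcont : ∀ s, ContinuousAt (radius C₁ C₂) s := fun s =>
    (hrmono.strictMonoOn univ).continuousAt_of_image_mem_nhds univ_mem
      (by rw [himage]; exact Ioi_mem_nhds (radius_pos hsurj s))
  refine contDiff_of_hasDerivAt_comp (v := fun r => (Real.sqrt (g₂ C₁ C₂ r))⁻¹) (U := Ioi 0)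
    ((contDiffOn_sqrt_g₂ hC₁ hC₂ hpos₂).inv fun r hr => (Real.sqrt_pos.2 (g₂_pos hpos₂ hr)).ne')
    (radius_pos hsurj) fun s => ?_
  exact HasDerivAt.of_local_left_inverse (hcont s)
    (hasDerivAt_W hC₁ hC₂ hpos₂ (radius_pos hsurj s))
    (Real.sqrt_pos.2 (g₂_pos hpos₂ (radius_pos hsurj s))).ne'
    (Eventually.of_forall (W_radius hsurj))

theorem warp_pos (hpos₁ : ∀ x > 0, 0 < C₁ x) (hsurj : SurjOn (W C₁ C₂) (Ioi 0) univ) (s : ℝ) :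
    0 < warp C₁ C₂ s := by
  have h := pow_pos (radius_pos hsurj s) 2
  exact mul_pos (mul_pos four_pos (hpos₁ _ h)) h

theorem contDiff_warp (hC₁ : ContDiffOn ℝ ∞ C₁ (Ioi 0)) (hC₂ : ContDiffOn ℝ ∞ C₂ (Ioi 0))
    (hpos₂ : ∀ x > 0, -(1 / x) * C₁ x < C₂ x) (hsurj : SurjOn (W C₁ C₂) (Ioi 0) univ) :
    ContDiff ℝ ∞ (warp C₁ C₂) := by
  have hr := (contDiff_radius hC₁ hC₂ hpos₂ hsurj).pow 2
  exact (contDiff_const.mul (contDiffOn_univ.1 (hC₁.comp hr.contDiffOn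
    fun s _ => pow_pos (radius_pos hsurj s) 2))).mul hr

end Warp

/-! ### First variation of the energy -/

/-- Differentiation of `∫ G(ε, t) dt` under the integral sign, for `G` of class `C¹`. -/
theorem hasDerivAt_integral_of_contDiffOn {δ : ℝ} (hδ : 0 < δ) {J : Set ℝ} (hJ : IsOpen J)
    {G : ℝ × ℝ → ℝ} (hG : ContDiffOn ℝ 1 G (Ioo (-δ) δ ×ˢ J)) {t₀ t₁ : ℝ} (h01 : t₀ ≤ t₁)
    (hsub : Icc t₀ t₁ ⊆ J) :
    HasDerivAt (fun ε => ∫ t in t₀..t₁, G (ε, t)) (∫ t in t₀..t₁, fderiv ℝ G (0, t) (1, 0)) 0 := by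
  have hU : IsOpen (Ioo (-δ) δ ×ˢ J) := isOpen_Ioo.prod hJ
  have hG' : ContinuousOn (fderiv ℝ G) (Ioo (-δ) δ ×ˢ J) :=
    hG.continuousOn_fderiv_of_isOpen hU le_rfl
  have hG'' : ContinuousOn (fun p => fderiv ℝ G p (1, 0)) (Ioo (-δ) δ ×ˢ J) :=
    hG'.clm_apply continuousOn_const
  have hslice : ∀ {g : ℝ × ℝ → ℝ}, ContinuousOn g (Ioo (-δ) δ ×ˢ J) → ∀ ε ∈ Ioo (-δ) δ,
      ContinuousOn (fun t => g (ε, t)) (Icc t₀ t₁) := fun hg ε hε =>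
    hg.comp (Continuous.prodMk_right ε).continuousOn fun t ht => ⟨hε, hsub ht⟩
  have h0 : (0 : ℝ) ∈ Ioo (-δ) δ := ⟨by linarith, hδ⟩
  have hKsub : Icc (-(δ / 2)) (δ / 2) ×ˢ Icc t₀ t₁ ⊆ Ioo (-δ) δ ×ˢ J :=
    prod_mono (fun x hx => ⟨by linarith [hx.1], by linarith [hx.2]⟩) hsub
  obtain ⟨C, hC⟩ := (isCompact_Icc.prod isCompact_Icc).exists_bound_of_continuousOn
    (hG''.mono hKsub)
  have hIoc : uIoc t₀ t₁ ⊆ Icc t₀ t₁ := by rw [uIoc_of_le h01]; exact Ioc_subset_Icc_self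
  refine (intervalIntegral.hasDerivAt_integral_of_dominated_loc_of_deriv_le
    (F := fun ε t => G (ε, t)) (F' := fun ε t => fderiv ℝ G (ε, t) (1, 0)) (bound := fun _ => C)
    (s := Ioo (-(δ / 2)) (δ / 2)) (Ioo_mem_nhds (by linarith) (by linarith)) ?_ ?_ ?_ ?_ ?_ ?_).2
  · filter_upwards [Ioo_mem_nhds h0.1 h0.2] with ε hε
    exact ((hslice hG.continuousOn ε hε).mono hIoc).aestronglyMeasurable measurableSet_uIoc
  · refine ContinuousOn.intervalIntegrable ?_
    rw [uIcc_of_le h01]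
    exact hslice hG.continuousOn 0 h0
  · exact ((hslice hG'' 0 h0).mono hIoc).aestronglyMeasurable measurableSet_uIoc
  · exact Eventually.of_forall fun t ht ε hε => hC (ε, t) ⟨Ioo_subset_Icc_self hε, hIoc ht⟩
  · exact intervalIntegrable_const
  · refine Eventually.of_forall fun t ht ε hε => ?_
    have hp : (ε, t) ∈ Ioo (-δ) δ ×ˢ J := hKsub ⟨Ioo_subset_Icc_self hε, hIoc ht⟩
    have hd := ((hG.differentiableOn (by norm_num)).differentiableAt (hU.mem_nhds hp)).hasFDerivAt
    have hl : HasDerivAt (fun ε : ℝ => (ε, t)) ((1 : ℝ), (0 : ℝ)) ε :=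
      (hasDerivAt_id ε).prodMk (hasDerivAt_const ε t)
    exact hd.comp_hasDerivAt ε hl

/-- The two mixed second partial derivatives of a smooth map on the plane exist and agree. -/
theorem hasDerivAt_fderiv_slice {E : Type*} [NormedAddCommGroup E] [NormedSpace ℝ E]
    {U : Set (ℝ × ℝ)} (hU : IsOpen U) {F : ℝ × ℝ → E} (hF : ContDiffOn ℝ ∞ F U) {x y : ℝ}
    (h : (x, y) ∈ U) :
    HasDerivAt (fun ε => fderiv ℝ F (ε, y) (0, 1))
      (fderiv ℝ (fderiv ℝ F) (x, y) (1, 0) (0, 1)) x ∧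
    HasDerivAt (fun t => fderiv ℝ F (x, t) (1, 0))
      (fderiv ℝ (fderiv ℝ F) (x, y) (1, 0) (0, 1)) y := by
  have hF' : ContDiffOn ℝ ∞ (fderiv ℝ F) U := ((contDiffOn_infty_iff_fderiv_of_isOpen hU).1 hF).2
  have hd : HasFDerivAt (fderiv ℝ F) (fderiv ℝ (fderiv ℝ F) (x, y)) (x, y) :=
    ((hF'.differentiableOn (by simp)).differentiableAt (hU.mem_nhds h)).hasFDerivAt
  have hsymm : IsSymmSndFDerivAt ℝ F (x, y) := by
    refine (hF.contDiffAt (hU.mem_nhds h)).isSymmSndFDerivAt ?_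
    rw [minSmoothness_of_isRCLikeNormedField]
    exact WithTop.coe_le_coe.2 (le_top : (2 : ℕ∞) ≤ ⊤)
  have h1 : HasDerivAt (fun ε : ℝ => fderiv ℝ F (ε, y))
      (fderiv ℝ (fderiv ℝ F) (x, y) (1, 0)) x :=
    HasFDerivAt.comp_hasDerivAt x hd ((hasDerivAt_id x).prodMk (hasDerivAt_const x y))
  have h2 : HasDerivAt (fun t : ℝ => fderiv ℝ F (x, t))
      (fderiv ℝ (fderiv ℝ F) (x, y) (0, 1)) y :=
    HasFDerivAt.comp_hasDerivAt y hd ((hasDerivAt_const y x).prodMk (hasDerivAt_id y))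
  constructor
  · have h3 := h1.clm_apply (hasDerivAt_const x ((0 : ℝ), (1 : ℝ)))
    rwa [map_zero, add_zero] at h3
  · have h3 := h2.clm_apply (hasDerivAt_const y ((1 : ℝ), (0 : ℝ)))
    rw [map_zero, add_zero] at h3
    rwa [hsymm (1, 0) (0, 1)]

theorem hasDerivAt_fst_of_prod {E F : Type*} [NormedAddCommGroup E] [NormedSpace ℝ E]
    [NormedAddCommGroup F] [NormedSpace ℝ F] {f : ℝ → E × F} {f' : E × F} {t : ℝ}
    (h : HasDerivAt f f' t) : HasDerivAt (fun x => (f x).1) f'.1 t :=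
  (hasFDerivAt_fst (𝕜 := ℝ) (p := f t)).comp_hasDerivAt t h

theorem hasDerivAt_snd_of_prod {E F : Type*} [NormedAddCommGroup E] [NormedSpace ℝ E]
    [NormedAddCommGroup F] [NormedSpace ℝ F] {f : ℝ → E × F} {f' : E × F} {t : ℝ}
    (h : HasDerivAt f f' t) : HasDerivAt (fun x => (f x).2) f'.2 t :=
  (hasFDerivAt_snd (𝕜 := ℝ) (p := f t)).comp_hasDerivAt t h

section Variation

variable {H : Type*} [NormedAddCommGroup H] [InnerProductSpace ℝ H]

/-- The `ds`-component `s'' - ½ a'(s) |φ'|²` of the geodesic equation of `ds² + a(s) ⟨dφ, dφ⟩`. -/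
def radialResidual (a : ℝ → ℝ) (s : ℝ → ℝ) (φ : ℝ → H) (t : ℝ) : ℝ :=
  deriv (deriv s) t - 1 / 2 * (deriv a (s t) * ‖deriv φ t‖ ^ 2)

/-- The component `(a(s) φ')' + a(s) |φ'|² φ` along the sphere of the geodesic equation of
`ds² + a(s) ⟨dφ, dφ⟩`; it is the projection of `(a(s) φ')'` to the orthogonal complement of `φ`. -/
def sphericalResidual (a : ℝ → ℝ) (s : ℝ → ℝ) (φ : ℝ → H) (t : ℝ) : H :=
  deriv (fun τ => a (s τ) • deriv φ τ) t + (a (s t) * ‖deriv φ t‖ ^ 2) • φ t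

theorem ContDiffOn.deriv_infty_of_isOpen {E : Type*} [NormedAddCommGroup E] [NormedSpace ℝ E]
    {f : ℝ → E} {J : Set ℝ} (hf : ContDiffOn ℝ ∞ f J) (hJ : IsOpen J) :
    ContDiffOn ℝ ∞ (deriv f) J :=
  ((contDiffOn_infty_iff_deriv_of_isOpen hJ).1 hf).2

theorem ContDiffOn.hasDerivAt_of_isOpen {E : Type*} [NormedAddCommGroup E] [NormedSpace ℝ E]
    {f : ℝ → E} {J : Set ℝ} (hf : ContDiffOn ℝ ∞ f J) (hJ : IsOpen J) {t : ℝ} (ht : t ∈ J) :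
    HasDerivAt f (deriv f t) t :=
  ((hf.differentiableOn (by simp)).differentiableAt (hJ.mem_nhds ht)).hasDerivAt

theorem contDiffOn_radialResidual {a : ℝ → ℝ} (ha : ContDiff ℝ ∞ a) {J : Set ℝ} (hJ : IsOpen J)
    {s : ℝ → ℝ} {φ : ℝ → H} (hs : ContDiffOn ℝ ∞ s J) (hφ : ContDiffOn ℝ ∞ φ J) :
    ContDiffOn ℝ ∞ (radialResidual a s φ) J := by
  have ha' : ContDiff ℝ ∞ (deriv a) := (contDiff_infty_iff_deriv.1 ha).2
  have hφ' := ContDiffOn.deriv_infty_of_isOpen hφ hJ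
  exact (ContDiffOn.deriv_infty_of_isOpen (ContDiffOn.deriv_infty_of_isOpen hs hJ) hJ).sub
    (contDiffOn_const.mul ((ha'.comp_contDiffOn hs).mul (hφ'.norm_sq ℝ)))

theorem contDiffOn_sphericalResidual {a : ℝ → ℝ} (ha : ContDiff ℝ ∞ a) {J : Set ℝ}
    (hJ : IsOpen J) {s : ℝ → ℝ} {φ : ℝ → H} (hs : ContDiffOn ℝ ∞ s J)
    (hφ : ContDiffOn ℝ ∞ φ J) : ContDiffOn ℝ ∞ (sphericalResidual a s φ) J := by
  have hφ' := ContDiffOn.deriv_infty_of_isOpen hφ hJ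
  exact (ContDiffOn.deriv_infty_of_isOpen ((ha.comp_contDiffOn hs).smul hφ') hJ).add
    (((ha.comp_contDiffOn hs).mul (hφ'.norm_sq ℝ)).smul hφ)

theorem inner_deriv_eq_zero {J : Set ℝ} (hJ : IsOpen J) {φ : ℝ → H} (hφ : ContDiffOn ℝ ∞ φ J)
    (hφ1 : ∀ t ∈ J, ‖φ t‖ = 1) {t : ℝ} (ht : t ∈ J) : inner ℝ (φ t) (deriv φ t) = 0 := by
  have h1 := (ContDiffOn.hasDerivAt_of_isOpen hφ hJ ht).norm_sq
  have h2 : HasDerivAt (fun τ => ‖φ τ‖ ^ 2) 0 t := by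
    refine (hasDerivAt_const t (1 : ℝ)).congr_of_eventuallyEq ?_
    filter_upwards [hJ.mem_nhds ht] with τ hτ
    rw [hφ1 τ hτ, one_pow]
  have := h1.unique h2
  linarith

theorem inner_sphericalResidual {a : ℝ → ℝ} (ha : ContDiff ℝ ∞ a) {J : Set ℝ} (hJ : IsOpen J)
    {s : ℝ → ℝ} {φ : ℝ → H} (hs : ContDiffOn ℝ ∞ s J) (hφ : ContDiffOn ℝ ∞ φ J)
    (hφ1 : ∀ t ∈ J, ‖φ t‖ = 1) {t : ℝ} (ht : t ∈ J) :
    inner ℝ (φ t) (sphericalResidual a s φ t) = 0 := by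
  have hP : ContDiffOn ℝ ∞ (fun τ => a (s τ) • deriv φ τ) J :=
    (ha.comp_contDiffOn hs).smul (ContDiffOn.deriv_infty_of_isOpen hφ hJ)
  have h1 := (ContDiffOn.hasDerivAt_of_isOpen hφ hJ ht).inner ℝ
    (ContDiffOn.hasDerivAt_of_isOpen hP hJ ht)
  have h2 : HasDerivAt (fun τ => inner ℝ (φ τ) (a (s τ) • deriv φ τ)) (0 : ℝ) t := by
    refine (hasDerivAt_const t (0 : ℝ)).congr_of_eventuallyEq ?_
    filter_upwards [hJ.mem_nhds ht] with τ hτ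
    rw [inner_smul_right, inner_deriv_eq_zero hJ hφ hφ1 hτ, mul_zero]
  have h3 := h1.unique h2
  rw [inner_smul_right, real_inner_self_eq_norm_sq] at h3
  rw [sphericalResidual, inner_add_right, inner_smul_right, real_inner_self_eq_norm_sq, hφ1 t ht]
  linarith

/-- The first variation formula: along a variation `F` of `c = (s, φ)` with fixed end points, the
energy has the derivative `-∫ ⟨residual of the geodesic equation, Y⟩ dt`, with `Y = ∂F/∂ε` at
`ε = 0`. -/
theorem hasDerivAt_energy {a : ℝ → ℝ} (ha : ContDiff ℝ ∞ a) {J : Set ℝ} (hJ : IsOpen J)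
    {δ : ℝ} (hδ : 0 < δ) {F : ℝ × ℝ → ℝ × H} (hF : ContDiffOn ℝ ∞ F (Ioo (-δ) δ ×ˢ J))
    (hF1 : ∀ p ∈ Ioo (-δ) δ ×ˢ J, ‖(F p).2‖ = 1)
    {s : ℝ → ℝ} {φ : ℝ → H} (hc : ∀ t ∈ J, F (0, t) = (s t, φ t))
    {t₀ t₁ : ℝ} (h01 : t₀ < t₁) (hsub : Icc t₀ t₁ ⊆ J)
    (h₀ : ∀ ε ∈ Ioo (-δ) δ, F (ε, t₀) = (s t₀, φ t₀))
    (h₁ : ∀ ε ∈ Ioo (-δ) δ, F (ε, t₁) = (s t₁, φ t₁))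
    {Y : ℝ → ℝ × H} (hY : ∀ t ∈ J, HasDerivAt (fun ε => F (ε, t)) (Y t) 0) :
    HasDerivAt (fun ε => energy a t₀ t₁ (fun t => F (ε, t)))
      (-∫ t in t₀..t₁, (radialResidual a s φ t * (Y t).1 +
        inner ℝ (sphericalResidual a s φ t) (Y t).2)) 0 := by
  have h0 : (0 : ℝ) ∈ Ioo (-δ) δ := ⟨by linarith, hδ⟩
  set U := Ioo (-δ) δ ×ˢ J with hUdef
  have hU : IsOpen U := isOpen_Ioo.prod hJ
  have hmem : ∀ {t}, t ∈ J → ((0 : ℝ), t) ∈ U := fun ht => ⟨h0, ht⟩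
  have hF' : ContDiffOn ℝ ∞ (fderiv ℝ F) U := ((contDiffOn_infty_iff_fderiv_of_isOpen hU).1 hF).2
  have hFd : ∀ p ∈ U, HasFDerivAt F (fderiv ℝ F p) p := fun p hp =>
    ((hF.differentiableOn (by simp)).differentiableAt (hU.mem_nhds hp)).hasFDerivAt
  have hl1 : ∀ ε t : ℝ, HasDerivAt (fun ε : ℝ => (ε, t)) ((1 : ℝ), (0 : ℝ)) ε := fun ε t =>
    (hasDerivAt_id ε).prodMk (hasDerivAt_const ε t)
  have hl2 : ∀ ε t : ℝ, HasDerivAt (fun t : ℝ => (ε, t)) ((0 : ℝ), (1 : ℝ)) t := fun ε t =>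
    (hasDerivAt_const t ε).prodMk (hasDerivAt_id t)
  -- the curve and its derivative in terms of `F`
  have hcF : ContDiffOn ℝ ∞ (fun t => F (0, t)) J :=
    hF.comp (contDiff_prodMk_right (0 : ℝ)).contDiffOn fun t ht => hmem ht
  have hcc : ContDiffOn ℝ ∞ (fun t => (s t, φ t)) J := hcF.congr fun t ht => (hc t ht).symm
  have hs : ContDiffOn ℝ ∞ s J := hcc.fst
  have hφ : ContDiffOn ℝ ∞ φ J := hcc.snd
  have hφ1 : ∀ t ∈ J, ‖φ t‖ = 1 := fun t ht => by
    have := hF1 _ (hmem ht)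
    rwa [hc t ht] at this
  have hs' := ContDiffOn.deriv_infty_of_isOpen hs hJ
  have hφ' := ContDiffOn.deriv_infty_of_isOpen hφ hJ
  have hP : ContDiffOn ℝ ∞ (fun τ => a (s τ) • deriv φ τ) J := (ha.comp_contDiffOn hs).smul hφ'
  have hFt : ∀ t ∈ J, fderiv ℝ F (0, t) (0, 1) = (deriv s t, deriv φ t) := fun t ht => by
    have h1 : HasDerivAt (fun τ => F (0, τ)) (fderiv ℝ F (0, t) (0, 1)) t :=
      (hFd _ (hmem ht)).comp_hasDerivAt t (hl2 0 t)
    have h2 : HasDerivAt (fun τ => F (0, τ)) (deriv s t, deriv φ t) t := by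
      refine ((ContDiffOn.hasDerivAt_of_isOpen hs hJ ht).prodMk
        (ContDiffOn.hasDerivAt_of_isOpen hφ hJ ht)).congr_of_eventuallyEq ?_
      filter_upwards [hJ.mem_nhds ht] with τ hτ using hc τ hτ
    exact h1.unique h2
  have hFe : ∀ t ∈ J, fderiv ℝ F (0, t) (1, 0) = Y t := fun t ht =>
    ((hFd _ (hmem ht)).comp_hasDerivAt (0 : ℝ) (hl1 0 t)).unique (hY t ht)
  -- the mixed second derivative
  obtain ⟨D, hD⟩ : ∃ D : ℝ → ℝ × H, ∀ t, fderiv ℝ (fderiv ℝ F) (0, t) (1, 0) (0, 1) = D t :=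
    ⟨_, fun _ => rfl⟩
  have hYd : ∀ t ∈ J, HasDerivAt Y (D t) t := fun t ht => by
    rw [← hD]
    refine (hasDerivAt_fderiv_slice hU hF (hmem ht)).2.congr_of_eventuallyEq ?_
    filter_upwards [hJ.mem_nhds ht] with τ hτ using (hFe τ hτ).symm
  have hDe : ∀ t ∈ J, HasDerivAt (fun ε => fderiv ℝ F (ε, t) (0, 1)) (D t) 0 := fun t ht =>
    hD t ▸ (hasDerivAt_fderiv_slice hU hF (hmem ht)).1
  -- the energy density
  set G : ℝ × ℝ → ℝ := fun p =>
    1 / 2 * metric a (F p) (fderiv ℝ F p (0, 1)) (fderiv ℝ F p (0, 1)) with hGdef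
  have hFtU : ContDiffOn ℝ ∞ (fun p => fderiv ℝ F p (0, 1)) U := hF'.clm_apply contDiffOn_const
  have hG : ContDiffOn ℝ ∞ G U :=
    contDiffOn_const.mul ((hFtU.fst.mul hFtU.fst).add
      ((ha.comp_contDiffOn hF.fst).mul (hFtU.snd.inner ℝ hFtU.snd)))
  have henergy : (fun ε => energy a t₀ t₁ (fun t => F (ε, t))) =ᶠ[𝓝 0]
      fun ε => ∫ t in t₀..t₁, G (ε, t) := by
    filter_upwards [Ioo_mem_nhds h0.1 h0.2] with ε hε
    refine intervalIntegral.integral_congr fun t ht => ?_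
    rw [uIcc_of_le h01.le] at ht
    have : deriv (fun t => F (ε, t)) t = fderiv ℝ F (ε, t) (0, 1) :=
      ((hFd _ ⟨hε, hsub ht⟩).comp_hasDerivAt t (hl2 ε t)).deriv
    simp only [hGdef, this]
  have hmain := (hasDerivAt_integral_of_contDiffOn hδ hJ (hG.of_le (by exact_mod_cast le_top))
    h01.le hsub).congr_of_eventuallyEq henergy
  refine hmain.congr_deriv ?_
  -- the derivative of the energy density, before the integration by parts
  have hGe : ∀ t ∈ J, fderiv ℝ G (0, t) (1, 0) = deriv s t * (D t).1 +
      (1 / 2 * (deriv a (s t) * ‖deriv φ t‖ ^ 2) * (Y t).1 +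
        a (s t) * inner ℝ (deriv φ t) (D t).2) := fun t ht => by
    have hGd := ((hG.differentiableOn (by simp)).differentiableAt
      (hU.mem_nhds (hmem ht))).hasFDerivAt.comp_hasDerivAt (0 : ℝ) (hl1 0 t)
    have had : HasDerivAt a (deriv a (s t)) (F (0, t)).1 := by
      rw [hc t ht]
      exact (ha.differentiable (by simp)).differentiableAt.hasDerivAt
    have hF1d : HasDerivAt (fun ε => (F (ε, t)).1) (Y t).1 0 := hasDerivAt_fst_of_prod (hY t ht)
    have h1 := hasDerivAt_fst_of_prod (hDe t ht)
    have h2 := hasDerivAt_snd_of_prod (hDe t ht)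
    have h3 := ((h1.mul h1).add ((had.comp (0 : ℝ) hF1d).mul (h2.inner ℝ h2))).const_mul
      (1 / 2 : ℝ)
    rw [hGd.unique h3]
    simp only [Function.comp, hFt t ht, hc t ht, real_inner_self_eq_norm_sq,
      real_inner_comm (deriv φ t) (D t).2]
    ring
  -- integration by parts
  have hparts : ∀ t ∈ J, HasDerivAt
      (fun τ => deriv s τ * (Y τ).1 + inner ℝ (a (s τ) • deriv φ τ) (Y τ).2)
      (fderiv ℝ G (0, t) (1, 0) + (radialResidual a s φ t * (Y t).1 +
        inner ℝ (sphericalResidual a s φ t) (Y t).2)) t := fun t ht => by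
    have h1 := (ContDiffOn.hasDerivAt_of_isOpen hs' hJ ht).mul (hasDerivAt_fst_of_prod (hYd t ht))
    have h2 := (ContDiffOn.hasDerivAt_of_isOpen hP hJ ht).inner ℝ
      (hasDerivAt_snd_of_prod (hYd t ht))
    -- the variation field is tangent to the sphere
    have horth : inner ℝ (φ t) (Y t).2 = 0 := by
      have h3 := (hasDerivAt_snd_of_prod (hY t ht)).norm_sq
      have h4 : HasDerivAt (fun ε => ‖(F (ε, t)).2‖ ^ 2) 0 0 := by
        refine (hasDerivAt_const (0 : ℝ) (1 : ℝ)).congr_of_eventuallyEq ?_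
        filter_upwards [Ioo_mem_nhds h0.1 h0.2] with ε hε
        rw [hF1 _ ⟨hε, ht⟩, one_pow]
      have h5 := h3.unique h4
      rw [hc t ht] at h5
      linarith
    refine (h1.add h2).congr_deriv ?_
    rw [hGe t ht, radialResidual, sphericalResidual, inner_add_left, inner_smul_left,
      inner_smul_left, horth]
    simp only [conj_trivial]
    ring
  have hYc : ContinuousOn Y J := fun t ht => (hYd t ht).continuousAt.continuousWithinAt
  have hres : ContinuousOn (fun t => radialResidual a s φ t * (Y t).1 +
      inner ℝ (sphericalResidual a s φ t) (Y t).2) J :=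
    ((contDiffOn_radialResidual ha hJ hs hφ).continuousOn.mul hYc.fst).add
      ((contDiffOn_sphericalResidual ha hJ hs hφ).continuousOn.inner hYc.snd)
  have hGc : ContinuousOn (fun t => fderiv ℝ G (0, t) (1, 0)) J :=
    ((((contDiffOn_infty_iff_fderiv_of_isOpen hU).1 hG).2.continuousOn).clm_apply
      continuousOn_const).comp (Continuous.prodMk_right (0 : ℝ)).continuousOn fun t ht => hmem ht
  have hIcc : uIcc t₀ t₁ ⊆ J := by rwa [uIcc_of_le h01.le]
  have hY0 : ∀ {t}, t ∈ J → (∀ ε ∈ Ioo (-δ) δ, F (ε, t) = (s t, φ t)) → Y t = 0 := by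
    intro t ht h
    refine (hY t ht).unique ((hasDerivAt_const (0 : ℝ) (s t, φ t)).congr_of_eventuallyEq ?_)
    filter_upwards [Ioo_mem_nhds h0.1 h0.2] with ε hε using h ε hε
  have hFTC := intervalIntegral.integral_eq_sub_of_hasDerivAt (fun t ht => hparts t (hIcc ht))
    (((hGc.add hres).mono hIcc).intervalIntegrable)
  rw [intervalIntegral.integral_add ((hGc.mono hIcc).intervalIntegrable)
    ((hres.mono hIcc).intervalIntegrable), hY0 (hsub ⟨le_rfl, h01.le⟩) h₀,
    hY0 (hsub ⟨h01.le, le_rfl⟩) h₁] at hFTC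
  simp only [Prod.fst_zero, Prod.snd_zero, mul_zero, inner_zero_right, add_zero, sub_zero] at hFTC
  linarith

end Variation

/-! ### Geodesics and the geodesic equation -/

theorem norm_snd_of_mem_cylinder {H : Type*} [NormedAddCommGroup H] {p : ℝ × H}
    (hp : p ∈ cylinder H) : ‖p.2‖ = 1 := by
  simpa using hp.2

theorem mem_cylinder {H : Type*} [NormedAddCommGroup H] {p : ℝ × H}
    (hp : ‖p.2‖ = 1) : p ∈ cylinder H :=
  ⟨mem_univ _, by simpa using hp⟩

section GeodesicEquation

variable {H : Type*} [NormedAddCommGroup H] [InnerProductSpace ℝ H]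

/-- The properties of the notion of smooth map into a subspace of `H` on which the theory of
geodesics of `ℝ × (S ∩ X)` rests: the smooth maps are smooth into `H`, take values in `X`, contain
the constants in `X`, form a module over the smooth real functions, and are stable under smooth changes
of the parameter and under differentiation of curves. -/
structure SmoothSpace.IsRegular (X : SmoothSpace H) : Prop where
  contDiffOn {P : Type} [NormedAddCommGroup P] [NormedSpace ℝ P] {U : Set P} {f : P → H} :
    X.IsSmooth U f → ContDiffOn ℝ ∞ f U
  mem_points {P : Type} [NormedAddCommGroup P] [NormedSpace ℝ P] {U : Set P} {f : P → H} :
    X.IsSmooth U f → ∀ p ∈ U, f p ∈ X.points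
  const {P : Type} [NormedAddCommGroup P] [NormedSpace ℝ P] (U : Set P) {h : H} :
    h ∈ X.points → X.IsSmooth U fun _ => h
  add {P : Type} [NormedAddCommGroup P] [NormedSpace ℝ P] {U : Set P} {f g : P → H} :
    X.IsSmooth U f → X.IsSmooth U g → X.IsSmooth U fun p => f p + g p
  smul {P : Type} [NormedAddCommGroup P] [NormedSpace ℝ P] {U : Set P} {k : P → ℝ} {f : P → H} :
    ContDiffOn ℝ ∞ k U → X.IsSmooth U f → X.IsSmooth U fun p => k p • f p
  comp {P Q : Type} [NormedAddCommGroup P] [NormedSpace ℝ P] [NormedAddCommGroup Q]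
    [NormedSpace ℝ Q] {U : Set P} {V : Set Q} {f : P → H} {g : Q → P} :
    X.IsSmooth U f → ContDiffOn ℝ ∞ g V → MapsTo g V U → X.IsSmooth V fun q => f (g q)
  deriv {J : Set ℝ} {f : ℝ → H} : IsOpen J → X.IsSmooth J f → X.IsSmooth J (deriv f)

theorem SmoothSpace.IsRegular.sphericalResidual {X : SmoothSpace H} (hX : X.IsRegular) {a : ℝ → ℝ}
    (ha : ContDiff ℝ ∞ a) {J : Set ℝ} (hJ : IsOpen J) {s : ℝ → ℝ} {φ : ℝ → H}
    (hs : ContDiffOn ℝ ∞ s J) (hφ : X.IsSmooth J φ) :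
    X.IsSmooth J (sphericalResidual a s φ) :=
  hX.add (hX.deriv hJ (hX.smul (ha.comp_contDiffOn hs) (hX.deriv hJ hφ)))
    (hX.smul ((ha.comp_contDiffOn hs).mul
      ((ContDiffOn.deriv_infty_of_isOpen (hX.contDiffOn hφ) hJ).norm_sq ℝ)) hφ)

theorem norm_normalized_add_smul {x y : H} (hx : ‖x‖ = 1) (hxy : inner ℝ x y = 0) (k : ℝ) :
    ‖(Real.sqrt (1 + k ^ 2 * ‖y‖ ^ 2))⁻¹ • x + ((Real.sqrt (1 + k ^ 2 * ‖y‖ ^ 2))⁻¹ * k) • y‖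
      = 1 := by
  have hpos : 0 < 1 + k ^ 2 * ‖y‖ ^ 2 := by positivity
  have hsq := Real.sq_sqrt hpos.le
  have hne := (Real.sqrt_pos.2 hpos).ne'
  rw [← pow_left_inj₀ (norm_nonneg _) zero_le_one two_ne_zero, norm_add_sq_real, inner_smul_left,
    inner_smul_right, hxy, norm_smul, norm_smul, mul_pow, mul_pow, hx, Real.norm_eq_abs,
    Real.norm_eq_abs, sq_abs, sq_abs]
  field_simp
  rw [hsq]
  simp

/-- A smooth curve in `ℝ × (S ∩ X)` is a geodesic iff it solves the geodesic equation. If the energy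
is stationary, it is so in the direction of the residual itself, times a weight `w` that
is positive inside an interval and vanishes at its end points; hence `∫ w |residual|² = 0`. -/
theorem isGeodesicOn_iff {X : SmoothSpace H} (hX : X.IsRegular) {a : ℝ → ℝ} (ha : ContDiff ℝ ∞ a)
    {J : Set ℝ} (hJ : IsOpen J) {c : ℝ → ℝ × H} :
    IsGeodesicOn a X J c ↔ SmoothInto X J c ∧ ∀ t ∈ J,
      radialResidual a (fun t => (c t).1) (fun t => (c t).2) t = 0 ∧
      sphericalResidual a (fun t => (c t).1) (fun t => (c t).2) t = 0 := by
  set s : ℝ → ℝ := fun t => (c t).1 with hsdef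
  set φ : ℝ → H := fun t => (c t).2 with hφdef
  have hzero : (0 : ℝ) ∈ Ioo (-1 : ℝ) 1 := by norm_num
  constructor
  · rintro ⟨hc, hcrit⟩
    refine ⟨hc, fun t ht => ?_⟩
    obtain ⟨hs, hφX, hcJ⟩ := hc
    have hφ := hX.contDiffOn hφX
    have hφ1 : ∀ t ∈ J, ‖φ t‖ = 1 := fun t ht => norm_snd_of_mem_cylinder (hcJ t ht).1
    have hR1 : ContDiffOn ℝ ∞ (radialResidual a s φ) J := contDiffOn_radialResidual ha hJ hs hφ
    have hR2X : X.IsSmooth J (sphericalResidual a s φ) := hX.sphericalResidual ha hJ hs hφX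
    have hR2 := hX.contDiffOn hR2X
    have horth : ∀ t ∈ J, inner ℝ (φ t) (sphericalResidual a s φ t) = 0 := fun t ht =>
      inner_sphericalResidual ha hJ hs hφ hφ1 ht
    -- an interval around `t` in `J`, and a weight that vanishes at its end points
    obtain ⟨r, hr, hrJ⟩ := Metric.isOpen_iff.1 hJ t ht
    have hsub : Icc (t - r / 2) (t + r / 2) ⊆ J := fun τ hτ => hrJ (by
      rw [Real.ball_eq_Ioo]
      exact ⟨by linarith [hτ.1], by linarith [hτ.2]⟩)
    set w : ℝ → ℝ := fun τ => (τ - (t - r / 2)) * (t + r / 2 - τ) with hw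
    have hwC : ContDiff ℝ ∞ w :=
      (contDiff_id.sub contDiff_const).mul (contDiff_const.sub contDiff_id)
    -- the normalised variation of `c` in the direction of `w` times the residual
    set k : ℝ × ℝ → ℝ := fun p => p.1 * w p.2 with hk
    set N : ℝ × ℝ → ℝ := fun p =>
      (Real.sqrt (1 + k p ^ 2 * ‖sphericalResidual a s φ p.2‖ ^ 2))⁻¹ with hN
    set F : ℝ × ℝ → ℝ × H := fun p => (s p.2 + k p * radialResidual a s φ p.2,
      N p • φ p.2 + (N p * k p) • sphericalResidual a s φ p.2) with hF
    have hsnd : ContDiffOn ℝ ∞ (fun p : ℝ × ℝ => p.2) (Ioo (-1) 1 ×ˢ J) := contDiff_snd.contDiffOn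
    have hmaps : MapsTo (fun p : ℝ × ℝ => p.2) (Ioo (-1) 1 ×ˢ J) J := fun p hp => hp.2
    have hkC : ContDiffOn ℝ ∞ k (Ioo (-1) 1 ×ˢ J) :=
      (contDiff_fst.mul (hwC.comp contDiff_snd)).contDiffOn
    have hNC : ContDiffOn ℝ ∞ N (Ioo (-1) 1 ×ˢ J) :=
      ((contDiffOn_const.add ((hkC.pow 2).mul ((hR2.comp hsnd hmaps).norm_sq ℝ))).sqrt
        fun p _ => by positivity).inv fun p _ => by positivity
    have hF2X : X.IsSmooth (Ioo (-1) 1 ×ˢ J) fun p => (F p).2 :=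
      hX.add (hX.smul hNC (hX.comp hφX hsnd hmaps))
        (hX.smul (hNC.mul hkC) (hX.comp hR2X hsnd hmaps))
    have hF1 : ContDiffOn ℝ ∞ (fun p => (F p).1) (Ioo (-1) 1 ×ˢ J) :=
      (hs.comp hsnd hmaps).add (hkC.mul (hR1.comp hsnd hmaps))
    have hFn : ∀ p ∈ Ioo (-1 : ℝ) 1 ×ˢ J, ‖(F p).2‖ = 1 := fun p hp =>
      norm_normalized_add_smul (hφ1 p.2 hp.2) (horth p.2 hp.2) (k p)
    have hk0 : ∀ p, k p = 0 → F p = (s p.2, φ p.2) := fun p hp => by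
      simp [hF, hN, hp]
    have hFe : ∀ t ∈ J, HasDerivAt (fun ε => F (ε, t))
        (w t * radialResidual a s φ t, w t • sphericalResidual a s φ t) 0 := fun t ht => by
      have hkd : HasDerivAt (fun ε => k (ε, t)) (w t) 0 := by
        simpa using (hasDerivAt_id (0 : ℝ)).mul_const (w t)
      have hk00 : k (0, t) = 0 := zero_mul _
      have hNd : HasDerivAt (fun ε => N (ε, t)) 0 0 := by
        have h1 := (((hkd.fun_pow 2).mul_const (‖sphericalResidual a s φ t‖ ^ 2)).const_add
          1).sqrt (by positivity)
        simpa [hk00] using h1.fun_inv (by positivity)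
      have hN0 : N (0, t) = 1 := by simp [hN, hk00]
      have h1 := (hkd.mul_const (radialResidual a s φ t)).const_add (s t)
      have h2 := (hNd.smul_const (φ t)).add ((hNd.mul hkd).smul_const (sphericalResidual a s φ t))
      refine (h1.prodMk h2).congr_deriv ?_
      simp [hk00, hN0]
    have hend : ∀ τ, w τ = 0 → ∀ ε ∈ Ioo (-1 : ℝ) 1, F (ε, τ) = (s τ, φ τ) := fun τ hτ ε _ =>
      hk0 _ (by simp [hk, hτ])
    have hcrit' := hcrit (t - r / 2) (t + r / 2) (by linarith) hsub 1 one_pos F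
      ⟨hF1, hF2X, fun p hp => ⟨mem_cylinder (hFn p hp), hX.mem_points hF2X p hp⟩⟩
      (fun τ _ => hk0 _ (by simp [hk]))
      (fun ε hε => ⟨hend _ (by simp [hw]) ε hε, hend _ (by simp [hw]) ε hε⟩)
    have hvar := hasDerivAt_energy ha hJ one_pos (hF1.prodMk (hX.contDiffOn hF2X)) hFn
      (fun τ _ => hk0 _ (by simp [hk])) (by linarith) hsub (hend _ (by simp [hw]))
      (hend _ (by simp [hw])) hFe
    have hint := hvar.unique hcrit'
    -- the integrand is `w` times the square of the residual
    set g : ℝ → ℝ := fun τ => w τ * (radialResidual a s φ τ ^ 2 +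
      ‖sphericalResidual a s φ τ‖ ^ 2) with hg
    have hgc : ContinuousOn g J := hwC.continuous.continuousOn.mul
      ((hR1.continuousOn.pow 2).add (hR2.continuousOn.norm.pow 2))
    have hgint : ∫ τ in (t - r / 2)..(t + r / 2), g τ = 0 := by
      rw [neg_eq_zero] at hint
      rw [← hint]
      refine intervalIntegral.integral_congr fun τ _ => ?_
      simp only [hg, inner_smul_right, real_inner_self_eq_norm_sq]
      ring
    have hwpos : 0 < w t := by
      simp only [hw]
      nlinarith
    have hgt : g t = 0 := by
      by_contra hne
      have hgnn : ∀ τ ∈ Icc (t - r / 2) (t + r / 2), 0 ≤ g τ := fun τ hτ =>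
        mul_nonneg (mul_nonneg (by linarith [hτ.1]) (by linarith [hτ.2])) (by positivity)
      have htm : t ∈ Icc (t - r / 2) (t + r / 2) := ⟨by linarith, by linarith⟩
      refine (intervalIntegral.integral_pos (by linarith) (hgc.mono hsub)
        (fun τ hτ => hgnn τ (Ioc_subset_Icc_self hτ))
        ⟨t, htm, lt_of_le_of_ne (hgnn t htm) (Ne.symm hne)⟩).ne' hgint
    have hsum := (mul_eq_zero.1 hgt).resolve_left hwpos.ne'
    have h1 := sq_nonneg (radialResidual a s φ t)
    have h2 := sq_nonneg ‖sphericalResidual a s φ t‖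
    exact ⟨pow_eq_zero_iff two_ne_zero |>.1 (by linarith),
      norm_eq_zero.1 (pow_eq_zero_iff two_ne_zero |>.1 (by linarith))⟩
  · rintro ⟨hc, hres⟩
    refine ⟨hc, fun t₀ t₁ h01 hsub δ hδ F hF hFc hFend => ?_⟩
    have hFC : ContDiffOn ℝ ∞ F (Ioo (-δ) δ ×ˢ J) := hF.1.prodMk (hX.contDiffOn hF.2.1)
    have hU : IsOpen (Ioo (-δ) δ ×ˢ J) := isOpen_Ioo.prod hJ
    have hd : ∀ t ∈ J, HasDerivAt (fun ε => F (ε, t)) (fderiv ℝ F (0, t) (1, 0)) 0 := fun t ht =>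
      HasFDerivAt.comp_hasDerivAt (0 : ℝ) (((hFC.differentiableOn (by simp)).differentiableAt
        (hU.mem_nhds ⟨⟨by linarith, hδ⟩, ht⟩)).hasFDerivAt)
        ((hasDerivAt_id (0 : ℝ)).prodMk (hasDerivAt_const (0 : ℝ) t))
    have hvar := hasDerivAt_energy (s := s) (φ := φ) ha hJ hδ hFC
      (fun p hp => norm_snd_of_mem_cylinder (hF.2.2 p hp).1) hFc h01 hsub
      (fun ε hε => (hFend ε hε).1) (fun ε hε => (hFend ε hε).2) hd
    refine hvar.congr_deriv ?_
    rw [neg_eq_zero, intervalIntegral.integral_congr (g := fun _ => (0 : ℝ)),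
      intervalIntegral.integral_zero]
    intro t ht
    rw [uIcc_of_le h01.le] at ht
    simp [(hres t (hsub ht)).1, (hres t (hsub ht)).2]

end GeodesicEquation

/-! ### Ordinary differential equations on intervals and on the line -/

/-- Two solutions of an autonomous equation with a `C¹` vector field on an open interval agree if
they agree at one point. -/
theorem eqOn_of_hasDerivAt_comp {E : Type*} [NormedAddCommGroup E] [NormedSpace ℝ E] {v : E → E}
    (hv : ContDiff ℝ 1 v) {J : Set ℝ} (hJ : IsOpen J) (hJc : IsPreconnected J) {f g : ℝ → E}
    (hf : ∀ t ∈ J, HasDerivAt f (v (f t)) t) (hg : ∀ t ∈ J, HasDerivAt g (v (g t)) t) {t₀ : ℝ}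
    (ht₀ : t₀ ∈ J) (h : f t₀ = g t₀) : EqOn f g J := by
  have hloc : ∀ t ∈ J, f t = g t → f =ᶠ[𝓝 t] g := fun t ht hfg => by
    obtain ⟨K, s, hs, hl⟩ := (hv.contDiffAt (x := f t)).exists_lipschitzOnWith
    refine ODE_solution_unique_of_eventually (v := fun _ => v) (s := fun _ => s)
      (Eventually.of_forall fun _ => hl) ?_ ?_ hfg
    · filter_upwards [hJ.mem_nhds ht, (hf t ht).continuousAt hs] with τ h1 h2
        using ⟨hf τ h1, h2⟩
    · filter_upwards [hJ.mem_nhds ht, (hg t ht).continuousAt (by rwa [← hfg])] with τ h1 h2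
        using ⟨hg τ h1, h2⟩
  have hsub : J ⊆ {t | f =ᶠ[𝓝 t] g} := by
    refine hJc.subset_of_closure_inter_subset isOpen_setOfPred_eventually_nhds
      ⟨t₀, ht₀, hloc t₀ ht₀ h⟩ fun t ht => hloc t ht.2 ?_
    by_contra hne
    have h1 : ∀ᶠ τ in 𝓝 t, f τ - g τ ≠ 0 :=
      ((hf t ht.2).continuousAt.sub (hg t ht.2).continuousAt).eventually_ne (sub_ne_zero.2 hne)
    obtain ⟨τ, hτ1, hτ2⟩ := ((mem_closure_iff_frequently.1 ht.1).and_eventually h1).exists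
    exact hτ2 (sub_eq_zero.2 hτ1.self_of_nhds)
  exact fun t ht => (hsub ht).self_of_nhds

/-- Solutions on all bounded symmetric intervals with a common initial value can be glued to a
solution on the line. -/
theorem exists_global_of_forall_Ioo {E : Type*} [NormedAddCommGroup E] [NormedSpace ℝ E]
    {v : E → E} (hv : ContDiff ℝ 1 v) (x : E)
    (h : ∀ T > 0, ∃ f : ℝ → E, f 0 = x ∧ ∀ t ∈ Ioo (-T) T, HasDerivAt f (v (f t)) t) :
    ∃ f : ℝ → E, f 0 = x ∧ ∀ t, HasDerivAt f (v (f t)) t := by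
  choose f hf0 hf using fun n : ℕ => h ((n : ℝ) + 1) (by positivity)
  have hagree : ∀ m n : ℕ, m ≤ n → ∀ t : ℝ, |t| ≤ m → f m t = f n t := fun m n hmn t ht => by
    have hmn' : (m : ℝ) ≤ n := by exact_mod_cast hmn
    refine eqOn_of_hasDerivAt_comp hv (isOpen_Ioo (a := -((m : ℝ) + 1)) (b := (m : ℝ) + 1))
      isPreconnected_Ioo (hf m)
      (fun τ hτ => hf n τ ⟨by linarith [hτ.1], by linarith [hτ.2]⟩) (t₀ := 0)
      ⟨by linarith [Nat.cast_nonneg (α := ℝ) m], by linarith [Nat.cast_nonneg (α := ℝ) m]⟩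
      ((hf0 m).trans (hf0 n).symm) ?_
    have := abs_le.1 ht
    exact ⟨by linarith [this.1], by linarith [this.2]⟩
  have hγ : ∀ N : ℕ, ∀ t : ℝ, |t| ≤ N → f ⌈|t|⌉₊ t = f N t := fun N t ht =>
    hagree _ N (Nat.ceil_le.2 ht) t (Nat.le_ceil _)
  refine ⟨fun t => f ⌈|t|⌉₊ t, hf0 _, fun t => ?_⟩
  obtain ⟨N, hN⟩ := exists_nat_gt |t|
  have ht : t ∈ Ioo (-((N : ℝ) + 1)) ((N : ℝ) + 1) := by
    have := abs_lt.1 hN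
    exact ⟨by linarith [this.1], by linarith [this.2]⟩
  have hev : (fun t => f ⌈|t|⌉₊ t) =ᶠ[𝓝 t] f N := by
    filter_upwards [continuous_abs.continuousAt.eventually_lt continuousAt_const hN] with τ hτ
      using hγ N τ hτ.le
  have := (hf N t ht).congr_of_eventuallyEq hev
  rwa [← hγ N t hN.le] at this

/-- The truncation of a real number to the interval `[x₀ - b, x₀ + b]`. -/
def truncate (x₀ b x : ℝ) : ℝ := max (x₀ - b) (min (x₀ + b) x)

theorem lipschitzWith_truncate (x₀ b : ℝ) : LipschitzWith 1 (truncate x₀ b) :=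
  (LipschitzWith.id.const_min _).const_max _

theorem truncate_mem_Icc {x₀ b : ℝ} (hb : 0 ≤ b) (x : ℝ) :
    truncate x₀ b x ∈ Icc (x₀ - b) (x₀ + b) :=
  ⟨le_max_left _ _, max_le (by linarith) (min_le_left _ _)⟩

theorem truncate_of_abs_le {x₀ b x : ℝ} (h : |x - x₀| ≤ b) : truncate x₀ b x = x := by
  have := abs_le.1 h
  rw [truncate, min_eq_right (by linarith), max_eq_right (by linarith)]

theorem integral_truncate_of_abs_le {b c : ℝ} (hc : |c| ≤ b) :
    ∫ x in (0 : ℝ)..c, truncate 0 b x = c ^ 2 / 2 := by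
  rw [intervalIntegral.integral_congr (g := fun x => x), integral_id]
  · ring
  · intro x hx
    refine truncate_of_abs_le ?_
    simpa using (abs_sub_left_of_mem_uIcc hx).trans (by simpa using hc)

/-- The truncated kinetic energy, an antiderivative of the truncation to `[-b, b]`, exceeds the
kinetic energy at speed `b` only beyond that speed. -/
theorem abs_le_of_integral_truncate_lt {b y : ℝ} (hb : 0 ≤ b)
    (h : ∫ x in (0 : ℝ)..y, truncate 0 b x < b ^ 2 / 2) : |y| ≤ b := by
  have hc : ∀ p q : ℝ, IntervalIntegrable (truncate 0 b) volume p q := fun p q =>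
    (lipschitzWith_truncate 0 b).continuous.intervalIntegrable p q
  by_contra! hy
  rcases lt_abs.1 hy with hy | hy
  · have h1 := intervalIntegral.integral_add_adjacent_intervals (hc 0 b) (hc b y)
    have h2 : 0 ≤ ∫ x in b..y, truncate 0 b x := intervalIntegral.integral_nonneg hy.le fun x hx =>
      le_max_of_le_right (le_min (by linarith) (hb.trans hx.1))
    rw [integral_truncate_of_abs_le (abs_of_nonneg hb).le] at h1
    linarith
  · have h1 := intervalIntegral.integral_add_adjacent_intervals (hc 0 (-b)) (hc (-b) y)
    have h2 : 0 ≤ ∫ x in (-b)..y, truncate 0 b x := by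
      rw [intervalIntegral.integral_symm, ← intervalIntegral.integral_neg]
      refine intervalIntegral.integral_nonneg (by linarith) fun x hx => ?_
      rw [neg_nonneg]
      exact max_le (by linarith) ((min_le_right _ _).trans (by linarith [hx.2]))
    rw [integral_truncate_of_abs_le (c := -b) (by rw [abs_neg, abs_of_nonneg hb])] at h1
    linarith [neg_sq b]

/-- Picard-Lindelöf for a bounded Lipschitz vector field: the solutions exist on every bounded
interval. -/
theorem exists_hasDerivAt_of_bounded_lipschitz {E : Type*} [NormedAddCommGroup E]
    [NormedSpace ℝ E] [CompleteSpace E] {v : E → E} {K L : NNReal} (hl : LipschitzWith K v)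
    (hb : ∀ x, ‖v x‖ ≤ L) (x : E) {T : ℝ} (hT : 0 < T) :
    ∃ f : ℝ → E, f 0 = x ∧ ∀ t ∈ Ioo (-T) T, HasDerivAt f (v (f t)) t := by
  have hPL : IsPicardLindelof (fun _ => v) (⟨0, by constructor <;> linarith⟩ : Icc (-T) T) x
      (L * T.toNNReal) 0 L K :=
    IsPicardLindelof.of_time_independent (fun y _ => hb y) hl.lipschitzOnWith (by
      simp [hT.le])
  obtain ⟨f, hf0, hf⟩ := hPL.exists_eq_forall_mem_Icc_hasDerivWithinAt₀
  exact ⟨f, hf0, fun t ht =>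
    (hf t (Ioo_subset_Icc_self ht)).hasDerivAt (Icc_mem_nhds ht.1 ht.2)⟩

/-- Newton's equation `s'' = -V'(s)` with a nonnegative potential has global solutions: by
conservation of energy, the speed is bounded. On a bounded time interval the position then stays in
a bounded interval, and the equation can be solved with velocity and position truncated. -/
theorem exists_newton_solution {V : ℝ → ℝ} (hV : ContDiff ℝ ∞ V) (hV0 : ∀ x, 0 ≤ V x)
    (x₀ v₀ : ℝ) : ∃ f : ℝ → ℝ × ℝ, f 0 = (x₀, v₀) ∧
      ∀ t, HasDerivAt f ((f t).2, -deriv V (f t).1) t := by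
  have hV' : ContDiff ℝ ∞ (deriv V) := (contDiff_infty_iff_deriv.1 hV).2
  have hVd : ∀ x, HasDerivAt V (deriv V x) x := fun x =>
    (hV.differentiable (by simp)).differentiableAt.hasDerivAt
  have hfield : ContDiff ℝ 1 fun p : ℝ × ℝ => (p.2, -deriv V p.1) :=
    contDiff_snd.prodMk ((hV'.of_le (by exact_mod_cast le_top)).comp contDiff_fst).neg
  refine exists_global_of_forall_Ioo hfield (x₀, v₀) fun T hT => ?_
  -- the energy of the initial state is less than the kinetic energy at speed `b`
  set e := v₀ ^ 2 / 2 + V x₀ with he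
  have he0 : 0 ≤ e := add_nonneg (by positivity) (hV0 x₀)
  set b := Real.sqrt (2 * e) + 1 with hb
  have hsq := Real.sq_sqrt (show 0 ≤ 2 * e by linarith)
  have hb0 : 0 ≤ b := by positivity
  have hbe : e < b ^ 2 / 2 := by nlinarith [Real.sqrt_nonneg (2 * e)]
  have hv₀ : |v₀| ≤ b := abs_le_of_sq_le_sq (by nlinarith [hV0 x₀]) hb0
  have hR : 0 ≤ b * T := by positivity
  have hV1 : ContDiff ℝ 1 (deriv V) := hV'.of_le (by exact_mod_cast le_top)
  obtain ⟨K, hK⟩ := (hV1.locallyLipschitz.locallyLipschitzOn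
    (s := Icc (x₀ - b * T) (x₀ + b * T))).exists_lipschitzOnWith_of_compact isCompact_Icc
  obtain ⟨B, hB⟩ := isCompact_Icc.exists_bound_of_continuousOn
    (hV'.continuous.continuousOn (s := Icc (x₀ - b * T) (x₀ + b * T)))
  set v : ℝ × ℝ → ℝ × ℝ := fun p => (truncate 0 b p.2, -deriv V (truncate x₀ (b * T) p.1)) with hv
  have hlip1 : LipschitzWith (K * 1) fun x => deriv V (truncate x₀ (b * T) x) := by
    rw [← lipschitzOnWith_univ]
    exact hK.comp (lipschitzWith_truncate _ _).lipschitzOnWith fun x _ => truncate_mem_Icc hR x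
  have hlip : LipschitzWith (max (1 * 1) (K * 1 * 1)) v :=
    ((lipschitzWith_truncate 0 b).comp LipschitzWith.prod_snd).prodMk
      ((hlip1.comp LipschitzWith.prod_fst).neg)
  have hbound : ∀ p, ‖v p‖ ≤ (max b B).toNNReal := fun p => by
    rw [Real.coe_toNNReal _ (hb0.trans (le_max_left _ _))]
    refine max_le_max ?_ ?_
    · have := truncate_mem_Icc (x₀ := 0) hb0 p.2
      exact abs_le.2 ⟨by linarith [this.1], by linarith [this.2]⟩
    · rw [norm_neg]
      exact hB _ (truncate_mem_Icc hR _)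
  obtain ⟨f, hf0, hf⟩ := exists_hasDerivAt_of_bounded_lipschitz hlip hbound (x₀, v₀) hT
  have h0 : (0 : ℝ) ∈ Ioo (-T) T := ⟨by linarith, hT⟩
  have hpos : ∀ t ∈ Ioo (-T) T, |(f t).1 - x₀| ≤ b * T := fun t ht => by
    have h1 := (convex_Ioo (-T) T).norm_image_sub_le_of_norm_hasDerivWithin_le
      (f := fun τ => (f τ).1) (C := b)
      (fun τ hτ => (hasDerivAt_fst_of_prod (hf τ hτ)).hasDerivWithinAt) (fun τ _ => by
        have := truncate_mem_Icc (x₀ := 0) hb0 (f τ).2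
        exact abs_le.2 ⟨by linarith [this.1], by linarith [this.2]⟩) h0 ht
    rw [hf0, sub_zero] at h1
    exact h1.trans (mul_le_mul_of_nonneg_left (abs_le.2 ⟨ht.1.le, ht.2.le⟩) hb0)
  have hcons : ∀ t ∈ Ioo (-T) T, (∫ x in (0 : ℝ)..(f t).2, truncate 0 b x) + V (f t).1 = e := by
    intro t ht
    have hκ : ∀ y, HasDerivAt (fun y => ∫ x in (0 : ℝ)..y, truncate 0 b x) (truncate 0 b y) y :=
      fun y => (lipschitzWith_truncate 0 b).continuous.integral_hasStrictDerivAt 0 y |>.hasDerivAt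
    have h1 := (convex_Ioo (-T) T).norm_image_sub_le_of_norm_hasDerivWithin_le
      (f := fun τ => (∫ x in (0 : ℝ)..(f τ).2, truncate 0 b x) + V (f τ).1) (C := 0)
      (fun τ hτ => (((hκ _).comp τ (hasDerivAt_snd_of_prod (hf τ hτ))).add
        ((hVd _).comp τ (hasDerivAt_fst_of_prod (hf τ hτ)))).hasDerivWithinAt) (fun τ hτ => by
        simp only [hv]
        rw [truncate_of_abs_le (hpos τ hτ), norm_le_zero_iff]
        ring) h0 ht
    rw [zero_mul, norm_le_zero_iff, sub_eq_zero, hf0] at h1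
    rw [h1, he, integral_truncate_of_abs_le hv₀]
  refine ⟨f, hf0, fun t ht => ?_⟩
  have hvel : |(f t).2 - 0| ≤ b := by
    rw [sub_zero]
    exact abs_le_of_integral_truncate_lt hb0 (by linarith [hcons t ht, hV0 (f t).1])
  have := hf t ht
  simp only [hv] at this
  rwa [truncate_of_abs_le (hpos t ht), truncate_of_abs_le hvel] at this

/-! ### Existence and uniqueness of geodesics -/

section Completeness

variable {H : Type*} [NormedAddCommGroup H] [InnerProductSpace ℝ H]

/-- Solutions of the geodesic equation on an open interval agree if they have the same position and
velocity at one time: the equation is a first-order system with smooth coefficients for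
`(s, s', φ, a(s) φ')`. -/
theorem eqOn_of_residual_eq_zero {a : ℝ → ℝ} (ha : ContDiff ℝ ∞ a) (hpos : ∀ x, 0 < a x)
    {J : Set ℝ} (hJ : IsOpen J) (hJc : IsPreconnected J) {c d : ℝ → ℝ × H}
    (hc : ContDiffOn ℝ ∞ c J) (hd : ContDiffOn ℝ ∞ d J)
    (hcR : ∀ t ∈ J, radialResidual a (fun t => (c t).1) (fun t => (c t).2) t = 0 ∧
      sphericalResidual a (fun t => (c t).1) (fun t => (c t).2) t = 0)
    (hdR : ∀ t ∈ J, radialResidual a (fun t => (d t).1) (fun t => (d t).2) t = 0 ∧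
      sphericalResidual a (fun t => (d t).1) (fun t => (d t).2) t = 0)
    {t₀ : ℝ} (ht₀ : t₀ ∈ J) (h : c t₀ = d t₀) (h' : deriv c t₀ = deriv d t₀) : EqOn c d J := by
  have ha' : ContDiff ℝ ∞ (deriv a) := (contDiff_infty_iff_deriv.1 ha).2
  -- the system for `((s, s'), (φ, a(s) φ'))`
  set v : (ℝ × ℝ) × (H × H) → (ℝ × ℝ) × (H × H) := fun z =>
    ((z.1.2, 1 / 2 * (deriv a z.1.1 * ‖(a z.1.1)⁻¹ • z.2.2‖ ^ 2)),
      ((a z.1.1)⁻¹ • z.2.2, -((a z.1.1 * ‖(a z.1.1)⁻¹ • z.2.2‖ ^ 2) • z.2.1))) with hv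
  have hvC : ContDiff ℝ ∞ v := by
    have h1 : ContDiff ℝ ∞ fun z : (ℝ × ℝ) × (H × H) => z.1.1 := contDiff_fst.comp contDiff_fst
    have h2 : ContDiff ℝ ∞ fun z : (ℝ × ℝ) × (H × H) => z.1.2 := contDiff_snd.comp contDiff_fst
    have h3 : ContDiff ℝ ∞ fun z : (ℝ × ℝ) × (H × H) => z.2.1 := contDiff_fst.comp contDiff_snd
    have h4 : ContDiff ℝ ∞ fun z : (ℝ × ℝ) × (H × H) => z.2.2 := contDiff_snd.comp contDiff_snd
    have h5 := ((ha.comp h1).inv fun z => (hpos _).ne').smul h4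
    exact (h2.prodMk (contDiff_const.mul ((ha'.comp h1).mul (h5.norm_sq ℝ)))).prodMk
      (h5.prodMk (((ha.comp h1).mul (h5.norm_sq ℝ)).smul h3).neg)
  have hsolve : ∀ c : ℝ → ℝ × H, ContDiffOn ℝ ∞ c J →
      (∀ t ∈ J, radialResidual a (fun t => (c t).1) (fun t => (c t).2) t = 0 ∧
        sphericalResidual a (fun t => (c t).1) (fun t => (c t).2) t = 0) →
      ∀ t ∈ J, HasDerivAt (fun t => (((c t).1, deriv (fun t => (c t).1) t),
          ((c t).2, a (c t).1 • deriv (fun t => (c t).2) t)))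
        (v (((c t).1, deriv (fun t => (c t).1) t),
          ((c t).2, a (c t).1 • deriv (fun t => (c t).2) t))) t := fun c hc hR t ht => by
    have hs := hc.fst
    have hφ := hc.snd
    have hP := (ha.comp_contDiffOn hs).smul (ContDiffOn.deriv_infty_of_isOpen hφ hJ)
    refine (((ContDiffOn.hasDerivAt_of_isOpen hs hJ ht).prodMk (ContDiffOn.hasDerivAt_of_isOpen
      (ContDiffOn.deriv_infty_of_isOpen hs hJ) hJ ht)).prodMk
      ((ContDiffOn.hasDerivAt_of_isOpen hφ hJ ht).prodMk
        (ContDiffOn.hasDerivAt_of_isOpen hP hJ ht))).congr_deriv ?_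
    simp only [hv, inv_smul_smul₀ (hpos (c t).1).ne']
    obtain ⟨hR1, hR2⟩ := hR t ht
    rw [radialResidual, sub_eq_zero] at hR1
    rw [sphericalResidual, add_eq_zero_iff_eq_neg] at hR2
    rw [hR1]
    exact congrArg _ (congrArg _ hR2)
  have hderiv : ∀ c : ℝ → ℝ × H, ContDiffOn ℝ ∞ c J →
      deriv (fun t => (c t).1) t₀ = (deriv c t₀).1 ∧ deriv (fun t => (c t).2) t₀ = (deriv c t₀).2 :=
    fun c hc => by
      have := ContDiffOn.hasDerivAt_of_isOpen hc hJ ht₀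
      exact ⟨(hasDerivAt_fst_of_prod this).deriv, (hasDerivAt_snd_of_prod this).deriv⟩
  have heq := eqOn_of_hasDerivAt_comp (hvC.of_le (by exact_mod_cast le_top)) hJ hJc
    (hsolve c hc hcR) (hsolve d hd hdR) ht₀ (by
      simp only [h, (hderiv c hc).1, (hderiv c hc).2, (hderiv d hd).1, (hderiv d hd).2, h'])
  intro t ht
  have := heq ht
  simp only [Prod.mk.injEq] at this
  exact Prod.ext this.1.1 this.2.1

/-- The geodesic with given initial data. Its component in the sphere runs through a great circle at
the angular velocity `K / a(s)`, with `K` the angular momentum, and `s` solves Newton's equation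
with the potential `K² / (2 a(s))`. -/
theorem exists_geodesic {X : SmoothSpace H} (hX : X.IsRegular) {a : ℝ → ℝ} (ha : ContDiff ℝ ∞ a)
    (hpos : ∀ x, 0 < a x) (t₀ : ℝ) {p v : ℝ × H} (hp : ‖p.2‖ = 1) (hpX : p.2 ∈ X.points)
    (hvX : v.2 ∈ X.points) (hpv : inner ℝ p.2 v.2 = 0) :
    ∃ c : ℝ → ℝ × H, IsGeodesicOn a X univ c ∧ c t₀ = p ∧ deriv c t₀ = v := by
  set K := a p.1 * ‖v.2‖ with hK
  set e : H := ‖v.2‖⁻¹ • v.2 with he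
  have heX : X.IsSmooth (univ : Set ℝ) fun _ => e := by
    rw [he]
    exact hX.smul contDiffOn_const (hX.const univ hvX)
  have hpe : inner ℝ p.2 e = 0 := by rw [he, inner_smul_right, hpv, mul_zero]
  -- if `v.2 = 0`, the junk value `e = 0` is harmless, as the angle stays zero
  have hcase : ‖e‖ = 1 ∨ K = 0 := by
    rcases eq_or_ne v.2 0 with h | h
    · exact Or.inr (by rw [hK, h, norm_zero, mul_zero])
    · refine Or.inl ?_
      rw [he, norm_smul, norm_inv, norm_norm, inv_mul_cancel₀ (norm_ne_zero_iff.2 h)]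
  have hve : (K / a p.1) • e = v.2 := by
    rw [hK, mul_div_cancel_left₀ _ (hpos _).ne', he]
    rcases eq_or_ne v.2 0 with h | h
    · simp [h]
    · rw [smul_inv_smul₀ (norm_ne_zero_iff.2 h)]
  -- the radial motion
  set V : ℝ → ℝ := fun x => K ^ 2 / 2 * (a x)⁻¹ with hVdef
  have hVC : ContDiff ℝ ∞ V := contDiff_const.mul (ha.inv fun x => (hpos x).ne')
  have hVd : ∀ x, deriv V x = -(1 / 2 * (deriv a x * (K / a x) ^ 2)) := fun x => by
    have had : HasDerivAt a (deriv a x) x :=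
      (ha.differentiable (by simp)).differentiableAt.hasDerivAt
    rw [((had.fun_inv (hpos x).ne').const_mul (K ^ 2 / 2)).deriv]
    have := (hpos x).ne'
    field_simp
  obtain ⟨f, hf0, hf⟩ := exists_newton_solution hVC
    (fun x => mul_nonneg (by positivity) (inv_nonneg.2 (hpos x).le)) p.1 v.1
  have hfC : ContDiff ℝ ∞ f := contDiff_of_hasDerivAt_comp (U := univ)
    (v := fun z : ℝ × ℝ => (z.2, -deriv V z.1)) (contDiff_snd.prodMk
      (((contDiff_infty_iff_deriv.1 hVC).2).comp contDiff_fst).neg).contDiffOn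
    (fun _ => mem_univ _) hf
  have hshift : ContDiff ℝ ∞ fun t : ℝ => t - t₀ := contDiff_id.sub contDiff_const
  set s : ℝ → ℝ := fun t => (f (t - t₀)).1 with hs
  have hsC : ContDiff ℝ ∞ s := (hfC.comp hshift).fst
  have hs0 : s t₀ = p.1 := by simp [hs, hf0]
  have hsd : ∀ t, HasDerivAt s (f (t - t₀)).2 t := fun t =>
    (hasDerivAt_fst_of_prod (hf (t - t₀))).comp_sub_const t t₀
  have hsd' : deriv s = fun t => (f (t - t₀)).2 := funext fun t => (hsd t).deriv
  have hsdd : ∀ t, HasDerivAt (deriv s) (-deriv V (s t)) t := fun t => by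
    rw [hsd']
    exact (hasDerivAt_snd_of_prod (hf (t - t₀))).comp_sub_const t t₀
  -- the angular velocity and the angle
  set α : ℝ → ℝ := fun t => K / a (s t) with hα
  have hαC : ContDiff ℝ ∞ α := contDiff_const.div (ha.comp hsC) fun t => (hpos _).ne'
  set θ : ℝ → ℝ := fun t => ∫ τ in t₀..t, α τ with hθ
  have hθd : ∀ t, HasDerivAt θ (α t) t := fun t =>
    (hαC.continuous.integral_hasStrictDerivAt t₀ t).hasDerivAt
  have hθC : ContDiff ℝ ∞ θ := contDiff_infty_iff_deriv.2
    ⟨fun t => (hθd t).differentiableAt, by rwa [funext fun t => (hθd t).deriv]⟩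
  have hθ0 : θ t₀ = 0 := intervalIntegral.integral_same
  have hθK : K = 0 → ∀ t, θ t = 0 := fun h t => by simp [hθ, hα, h]
  -- the great circle
  set φ : ℝ → H := fun t => Real.cos (θ t) • p.2 + Real.sin (θ t) • e with hφ
  set ψ : ℝ → H := fun t => -Real.sin (θ t) • p.2 + Real.cos (θ t) • e with hψ
  have hφX : X.IsSmooth univ φ :=
    hX.add (hX.smul (Real.contDiff_cos.comp hθC).contDiffOn (hX.const univ hpX))
      (hX.smul (Real.contDiff_sin.comp hθC).contDiffOn heX)
  have hφd : ∀ t, HasDerivAt φ (α t • ψ t) t := fun t => by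
    refine (((hθd t).cos.smul_const p.2).add ((hθd t).sin.smul_const e)).congr_deriv ?_
    simp only [hψ, smul_add, smul_smul]
    congr 2 <;> ring
  have hψd : ∀ t, HasDerivAt ψ (-(α t • φ t)) t := fun t => by
    refine (((hθd t).sin.fun_neg.smul_const p.2).add ((hθd t).cos.smul_const e)).congr_deriv ?_
    simp only [hφ, smul_add, smul_smul, neg_add, ← neg_smul]
    congr 2 <;> ring
  have hnorm : ∀ x y : ℝ, ‖x • p.2 + y • e‖ ^ 2 = x ^ 2 + y ^ 2 * ‖e‖ ^ 2 := fun x y => by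
    rw [norm_add_sq_real, inner_smul_left, inner_smul_right, hpe, norm_smul, norm_smul, hp,
      Real.norm_eq_abs, Real.norm_eq_abs, mul_pow, mul_pow, sq_abs, sq_abs]
    ring
  have hφ1 : ∀ t, ‖φ t‖ = 1 := fun t => by
    rw [← pow_left_inj₀ (norm_nonneg _) zero_le_one two_ne_zero, hnorm]
    rcases hcase with h | h
    · rw [h]
      linarith [Real.sin_sq_add_cos_sq (θ t)]
    · simp [hθK h t]
  have hαψ : ∀ t, ‖α t • ψ t‖ ^ 2 = α t ^ 2 := fun t => by
    rw [norm_smul, mul_pow, Real.norm_eq_abs, sq_abs, hnorm]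
    rcases hcase with h | h
    · rw [h, neg_sq, one_pow, mul_one, Real.sin_sq_add_cos_sq, mul_one]
    · simp [hα, h]
  have hφd' : deriv φ = fun t => α t • ψ t := funext fun t => (hφd t).deriv
  refine ⟨fun t => (s t, φ t), (isGeodesicOn_iff hX ha isOpen_univ).2 ⟨⟨hsC.contDiffOn, hφX,
    fun t _ => ⟨mem_cylinder (hφ1 t), hX.mem_points hφX t (mem_univ t)⟩⟩, fun t _ => ⟨?_, ?_⟩⟩,
    ?_, ?_⟩
  · change radialResidual a s φ t = 0
    rw [radialResidual, (hsdd t).deriv, hφd', hαψ, hVd, neg_neg, sub_self]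
  · change sphericalResidual a s φ t = 0
    have hmom : (fun τ => a (s τ) • deriv φ τ) = K • ψ := funext fun τ => by
      rw [hφd', smul_smul, hα, mul_div_cancel₀ _ (hpos _).ne', Pi.smul_apply]
    rw [sphericalResidual, hmom, ((hψd t).const_smul K).deriv, hφd', hαψ, smul_neg, smul_smul,
      neg_add_eq_zero]
    congr 1
    have := (hpos (s t)).ne'
    simp only [hα]
    field_simp
  · simp [hs0, hφ, hθ0]
  · have h1 := ((hsd t₀).prodMk (hφd t₀)).deriv
    rw [h1]
    refine Prod.ext (by simp [hf0]) ?_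
    simp only [hψ, hα, hθ0, hs0, Real.sin_zero, Real.cos_zero, neg_zero, zero_smul, zero_add,
      one_smul]
    exact hve

/-- A warped product `ds² + a(s) ⟨dφ, dφ⟩` of the line and a sphere, with `a > 0` smooth on the
line, is geodesically complete. -/
theorem isGeodesicallyComplete {X : SmoothSpace H} (hX : X.IsRegular) {a : ℝ → ℝ}
    (ha : ContDiff ℝ ∞ a) (hpos : ∀ x, 0 < a x) : IsGeodesicallyComplete a X := by
  refine ⟨fun p v hp hpX hvX hpv =>
    exists_geodesic hX ha hpos 0 (norm_snd_of_mem_cylinder hp) hpX hvX hpv, ?_⟩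
  rintro J c hJ hJc ⟨t₀, ht₀⟩ hc
  obtain ⟨⟨hs, hφX, hcJ⟩, hres⟩ := (isGeodesicOn_iff hX ha hJ).1 hc
  have hφ := hX.contDiffOn hφX
  have hcd := ContDiffOn.hasDerivAt_of_isOpen (hs.prodMk hφ) hJ ht₀
  have hd2 := (hasDerivAt_snd_of_prod hcd).deriv
  obtain ⟨c', hc', h0, h0'⟩ := exists_geodesic hX ha hpos t₀ (p := c t₀) (v := deriv c t₀)
    (norm_snd_of_mem_cylinder (hcJ t₀ ht₀).1) (hcJ t₀ ht₀).2
    (hd2 ▸ hX.mem_points (hX.deriv hJ hφX) t₀ ht₀)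
    (hd2 ▸ inner_deriv_eq_zero hJ hφ (fun t ht => norm_snd_of_mem_cylinder (hcJ t ht).1) ht₀)
  obtain ⟨⟨hs', hφX', _⟩, hres'⟩ := (isGeodesicOn_iff hX ha isOpen_univ).1 hc'
  exact ⟨c', hc', eqOn_of_residual_eq_zero ha hpos hJ hJc.isPreconnected
    ((hs'.prodMk (hX.contDiffOn hφX')).mono (subset_univ J)) (hs.prodMk hφ)
    (fun t _ => hres' t (mem_univ t)) hres ht₀ h0 h0'⟩

end Completeness

/-! ### Smooth curves in the Hilbert space and in the space of smooth functions -/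

theorem isRegular_fullSpace (H : Type*) [NormedAddCommGroup H] [InnerProductSpace ℝ H] :
    (fullSpace H).IsRegular where
  contDiffOn hf := hf
  mem_points _ _ _ := mem_univ _
  const _ _ _ := contDiffOn_const
  add hf hg := ContDiffOn.add hf hg
  smul hk hf := ContDiffOn.smul hk hf
  comp hf hg hmaps := ContDiffOn.comp hf hg hmaps
  deriv hJ hf := ContDiffOn.deriv_infty_of_isOpen hf hJ

/-- If a curve in `L^p` is represented, at all times near `t`, by functions that are differentiable
in time at each point, then its derivative is represented by the pointwise derivative: the
difference quotients converge in `L^p`, hence a subsequence converges almost everywhere. -/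
theorem ae_eq_deriv_of_hasDerivAt_Lp {α : Type*} [MeasurableSpace α] {μ : Measure α}
    {p : ℝ≥0∞} [Fact (1 ≤ p)] {f : ℝ → Lp ℝ p μ} {f' : Lp ℝ p μ}
    {u : ℝ → α → ℝ} {u' : α → ℝ} {t : ℝ}
    (hf : HasDerivAt f f' t) (hfu : ∀ᶠ τ in 𝓝 t, f τ =ᵐ[μ] u τ)
    (hu : ∀ x, HasDerivAt (fun τ => u τ x) (u' x) t) : f' =ᵐ[μ] u' := by
  have hseq : Tendsto (fun n : ℕ => t + 1 / ((n : ℝ) + 1)) atTop (𝓝[≠] t) := by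
    refine tendsto_nhdsWithin_iff.2 ⟨?_, Eventually.of_forall fun n => ?_⟩
    · simpa using (tendsto_const_nhds (x := t)).add tendsto_one_div_add_atTop_nhds_zero_nat
    · have : (0 : ℝ) < 1 / ((n : ℝ) + 1) := by positivity
      simp only [mem_compl_iff, mem_singleton_iff]
      linarith
  have hLp : Tendsto (fun n : ℕ => slope f t (t + 1 / ((n : ℝ) + 1))) atTop (𝓝 f') :=
    (hasDerivAt_iff_tendsto_slope.1 hf).comp hseq
  have hmeas := tendstoInMeasure_of_tendsto_Lp hLp
  obtain ⟨ns, hns, hae⟩ := hmeas.exists_seq_tendsto_ae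
  have hslope : ∀ᶠ n : ℕ in atTop, slope f t (t + 1 / ((n : ℝ) + 1)) =ᵐ[μ]
      fun x => slope (fun τ => u τ x) t (t + 1 / ((n : ℝ) + 1)) := by
    filter_upwards [(hseq.mono_right nhdsWithin_le_nhds).eventually hfu] with n hn
    rw [slope_def_module]
    filter_upwards [Lp.coeFn_smul ((t + 1 / ((n : ℝ) + 1) - t)⁻¹)
      (f (t + 1 / ((n : ℝ) + 1)) - f t), Lp.coeFn_sub (f (t + 1 / ((n : ℝ) + 1))) (f t), hn,
      hfu.self_of_nhds] with x h1 h2 h3 h4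
    rw [h1, Pi.smul_apply, h2, Pi.sub_apply, h3, h4, slope_def_module]
  obtain ⟨N, hN⟩ := eventually_atTop.1 hslope
  have hall : ∀ᵐ x ∂μ, ∀ n, N ≤ n → slope f t (t + 1 / ((n : ℝ) + 1)) x =
      slope (fun τ => u τ x) t (t + 1 / ((n : ℝ) + 1)) :=
    ae_all_iff.2 fun n => by
      by_cases hn : N ≤ n
      · filter_upwards [hN n hn] with x hx _ using hx
      · exact Eventually.of_forall fun x h => absurd h hn
  filter_upwards [hae, hall] with x h1 h2
  have h3 : Tendsto (fun i => slope (fun τ => u τ x) t (t + 1 / ((ns i : ℝ) + 1))) atTop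
      (𝓝 (u' x)) :=
    ((hasDerivAt_iff_tendsto_slope.1 (hu x)).comp hseq).comp hns.tendsto_atTop
  refine tendsto_nhds_unique h1 (h3.congr' ?_)
  filter_upwards [hns.tendsto_atTop.eventually_ge_atTop N] with i hi using (h2 _ hi).symm

section Manifold

variable {m : ℕ} {B : Type*} [TopologicalSpace B]
  (I : ModelWithCorners ℝ (EuclideanSpace ℝ (Fin m)) B)
  {M : Type*} [TopologicalSpace M] [ChartedSpace B M]

/-- The partial derivative with respect to time of a smooth function of time and of a point of a
manifold is again smooth in both variables. -/
theorem contMDiffOn_deriv_fst [IsManifold I ∞ M] {J : Set ℝ} (hJ : IsOpen J) {u : ℝ → M → ℝ}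
    (hu : ContMDiffOn (𝓘(ℝ, ℝ).prod I) 𝓘(ℝ, ℝ) ∞ (fun q : ℝ × M => u q.1 q.2) (J ×ˢ univ)) :
    ContMDiffOn (𝓘(ℝ, ℝ).prod I) 𝓘(ℝ, ℝ) ∞
      (fun q : ℝ × M => deriv (fun t => u t q.2) q.1) (J ×ˢ univ) := by
  rintro ⟨t, x⟩ ⟨ht, -⟩
  refine ContMDiffAt.contMDiffWithinAt ?_
  have hut : ContMDiffAt (𝓘(ℝ, ℝ).prod I) 𝓘(ℝ, ℝ) ∞ (fun q : ℝ × M => u q.1 q.2) (t, x) :=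
    hu.contMDiffAt ((hJ.prod isOpen_univ).mem_nhds ⟨ht, mem_univ x⟩)
  have hf : ContMDiffAt ((𝓘(ℝ, ℝ).prod I).prod 𝓘(ℝ, ℝ)) 𝓘(ℝ, ℝ) ∞
      (Function.uncurry fun (q : ℝ × M) (τ : ℝ) => u τ q.2) ((t, x), t) :=
    ContMDiffAt.comp (g := fun q : ℝ × M => u q.1 q.2)
      (f := fun z : (ℝ × M) × ℝ => (z.2, z.1.2)) ((t, x), t) hut
      (contMDiffAt_snd.prodMk (contMDiffAt_snd.comp _ contMDiffAt_fst))
  have h := ContMDiffAt.mfderiv_apply (J := 𝓘(ℝ, ℝ).prod I) (I := 𝓘(ℝ, ℝ)) (I' := 𝓘(ℝ, ℝ))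
    (J' := 𝓘(ℝ, ℝ).prod I) (m := ∞) (n := ∞) (x₀ := (t, x))
    (fun (q : ℝ × M) (τ : ℝ) => u τ q.2) (fun q => q.1) (fun q => q) (fun _ => (1 : ℝ))
    hf contMDiffAt_fst contMDiffAt_id contMDiffAt_const (by simp)
  simpa only [inTangentCoordinates_model_space, mfderiv_eq_fderiv, fderiv_eq_deriv_mul,
    mul_one] using h

theorem isRegular_smoothFunctions [IsManifold I ∞ M] [MeasurableSpace M] (μ : Measure M) :
    (smoothFunctions I μ).IsRegular where
  contDiffOn hf := hf.1
  mem_points {P _ _ U f} hf p hp := by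
    obtain ⟨_, u, hu, hfu⟩ := hf
    refine ⟨u p, ?_, hfu p hp⟩
    rw [← contMDiffOn_univ]
    exact hu.comp (t := U ×ˢ univ) (f := fun x : M => (p, x))
      (contMDiff_const.prodMk contMDiff_id).contMDiffOn fun x _ => ⟨hp, mem_univ x⟩
  const U h hh := by
    obtain ⟨u, hu, hhu⟩ := hh
    exact ⟨contDiffOn_const, fun _ => u, (hu.comp contMDiff_snd).contMDiffOn, fun _ _ => hhu⟩
  add {P _ _ U f g} hf hg := by
    obtain ⟨hf, u, hu, hfu⟩ := hf
    obtain ⟨hg, w, hw, hgw⟩ := hg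
    refine ⟨hf.add hg, fun p x => u p x + w p x, hu.add hw, fun p hp => ?_⟩
    filter_upwards [Lp.coeFn_add (f p) (g p), hfu p hp, hgw p hp] with x h1 h2 h3
    rw [h1, Pi.add_apply, h2, h3]
  smul {P _ _ U k f} hk hf := by
    obtain ⟨hf, u, hu, hfu⟩ := hf
    refine ⟨hk.smul hf, fun p x => k p * u p x, ?_, fun p hp => ?_⟩
    · exact ((contMDiffOn_iff_contDiffOn.2 hk).comp contMDiffOn_fst fun q hq => hq.1).mul hu
    · filter_upwards [Lp.coeFn_smul (k p) (f p), hfu p hp] with x h1 h2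
      rw [h1, Pi.smul_apply, h2, smul_eq_mul]
  comp {P Q _ _ _ _ U V f g} hf hg hmaps := by
    obtain ⟨hf, u, hu, hfu⟩ := hf
    refine ⟨hf.comp hg hmaps, fun q => u (g q), ?_, fun q hq => hfu _ (hmaps hq)⟩
    exact hu.comp (t := U ×ˢ univ) (f := fun z : Q × M => (g z.1, z.2))
      (((contMDiffOn_iff_contDiffOn.2 hg).comp contMDiffOn_fst fun z hz => hz.1).prodMk
        contMDiffOn_snd) fun z hz => ⟨hmaps hz.1, mem_univ _⟩
  deriv {J f} hJ hf := by
    obtain ⟨hf, u, hu, hfu⟩ := hf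
    refine ⟨ContDiffOn.deriv_infty_of_isOpen hf hJ, fun t x => deriv (fun τ => u τ x) t,
      contMDiffOn_deriv_fst I hJ hu, fun t ht => ?_⟩
    refine ae_eq_deriv_of_hasDerivAt_Lp (u := u)
      (ContDiffOn.hasDerivAt_of_isOpen hf hJ ht) ?_ fun x => ?_
    · filter_upwards [hJ.mem_nhds ht] with τ hτ using hfu τ hτ
    · have hux : ContMDiffOn 𝓘(ℝ, ℝ) 𝓘(ℝ, ℝ) ∞ (fun τ => u τ x) J :=
        hu.comp (t := J ×ˢ univ) (f := fun τ : ℝ => (τ, x))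
          (contMDiff_id.prodMk contMDiff_const).contMDiffOn fun τ hτ => ⟨hτ, mem_univ x⟩
      exact ContDiffOn.hasDerivAt_of_isOpen (contMDiffOn_iff_contDiffOn.1 hux) hJ ht

end Manifold

/-! ### The length of curves -/

section Length

variable {H : Type*} [NormedAddCommGroup H] [InnerProductSpace ℝ H]

/-- The speed of a curve `γ : [0, 1] → ℝ × S`. -/
def speed (a : ℝ → ℝ) (γ : ℝ → ℝ × H) (t : ℝ) : ℝ :=
  Real.sqrt (metric a (γ t) (derivWithin γ (Icc 0 1) t) (derivWithin γ (Icc 0 1) t))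

theorem length_eq_lintegral_Ioo (a : ℝ → ℝ) (γ : ℝ → ℝ × H) :
    length a γ = ∫⁻ t in Ioo (0 : ℝ) 1, ENNReal.ofReal (speed a γ t) :=
  (setLIntegral_congr Ioo_ae_eq_Icc).symm

theorem metric_self (a : ℝ → ℝ) (p v : ℝ × H) : metric a p v v = v.1 ^ 2 + a p.1 * ‖v.2‖ ^ 2 := by
  rw [metric, real_inner_self_eq_norm_sq, sq v.1]

theorem metric_smul_self (a : ℝ → ℝ) (p v : ℝ × H) (k : ℝ) :
    metric a p (k • v) (k • v) = k ^ 2 * metric a p v v := by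
  simp only [metric_self, Prod.smul_fst, Prod.smul_snd, smul_eq_mul, norm_smul, mul_pow,
    Real.norm_eq_abs, sq_abs]
  ring

theorem speed_comp {a : ℝ → ℝ} {γ γ₁ : ℝ → ℝ × H} (hγ₁ : ContDiffOn ℝ 1 γ₁ (Icc 0 1))
    {h : ℝ → ℝ} {k t : ℝ} (ht : t ∈ Ioo (0 : ℝ) 1) (hev : γ =ᶠ[𝓝 t] γ₁ ∘ h)
    (hmaps : ∀ᶠ τ in 𝓝 t, h τ ∈ Icc (0 : ℝ) 1) (hk : HasDerivAt h k t) :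
    speed a γ t = |k| * speed a γ₁ (h t) := by
  have h1 : HasDerivWithinAt γ₁ (derivWithin γ₁ (Icc 0 1) (h t)) (Icc 0 1) (h t) :=
    ((hγ₁.differentiableOn (by simp)) _ hmaps.self_of_nhds).hasDerivWithinAt
  have h2 : HasDerivAt (γ₁ ∘ h) (k • derivWithin γ₁ (Icc 0 1) (h t)) t :=
    (h1.scomp t (hk.hasDerivWithinAt (s := h ⁻¹' Icc 0 1)) fun _ hτ => hτ).hasDerivAt hmaps
  have h3 : derivWithin γ (Icc 0 1) t = k • derivWithin γ₁ (Icc 0 1) (h t) := by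
    rw [derivWithin_of_mem_nhds (Icc_mem_nhds ht.1 ht.2)]
    exact (h2.congr_of_eventuallyEq hev).deriv
  rw [speed, speed, h3, metric_smul_self, hev.self_of_nhds, Real.sqrt_mul (sq_nonneg k),
    Real.sqrt_sq_eq_abs, Function.comp_apply]

/-- Invariance of the length under a change of parameter `h` from `s` to the unit interval; `hcov`
is the change of variables formula for `h`. -/
theorem lintegral_speed_comp {a : ℝ → ℝ} {γ γ₁ : ℝ → ℝ × H} (hγ₁ : ContDiffOn ℝ 1 γ₁ (Icc 0 1))
    {s : Set ℝ} (hs : s ⊆ Ioo 0 1) (hsm : MeasurableSet s) {h k : ℝ → ℝ}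
    (hev : ∀ t ∈ s, γ =ᶠ[𝓝 t] γ₁ ∘ h) (hmaps : ∀ t ∈ s, ∀ᶠ τ in 𝓝 t, h τ ∈ Icc (0 : ℝ) 1)
    (hk : ∀ t ∈ s, HasDerivAt h (k t) t) (himg : h '' s = Ioo 0 1)
    (hcov : ∀ u : ℝ → ℝ≥0∞, ∫⁻ x in h '' s, u x = ∫⁻ x in s, ENNReal.ofReal |k x| * u (h x)) :
    ∫⁻ t in s, ENNReal.ofReal (speed a γ t) = length a γ₁ := by
  rw [length_eq_lintegral_Ioo, ← himg, hcov]
  refine setLIntegral_congr_fun hsm fun t ht => ?_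
  rw [speed_comp hγ₁ (hs ht) (hev t ht) (hmaps t ht) (hk t ht), ENNReal.ofReal_mul (abs_nonneg _)]

theorem length_reverse {a : ℝ → ℝ} {γ : ℝ → ℝ × H} (hγ : ContDiffOn ℝ 1 γ (Icc 0 1)) :
    length a (fun t => γ (1 - t)) = length a γ := by
  have himg : (fun t : ℝ => 1 - t) '' Ioo 0 1 = Ioo 0 1 := by simp
  have hd : ∀ t : ℝ, HasDerivAt (fun t : ℝ => 1 - t) (-1) t := fun t =>
    (hasDerivAt_id t).const_sub 1
  rw [length_eq_lintegral_Ioo]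
  refine lintegral_speed_comp (h := fun t => 1 - t) (k := fun _ => -1) hγ Subset.rfl
    measurableSet_Ioo (fun t _ => EventuallyEq.rfl) (fun t ht => ?_) (fun t _ => hd t) himg
    fun u => lintegral_image_eq_lintegral_abs_deriv_mul measurableSet_Ioo
      (fun t _ => (hd t).hasDerivWithinAt) (sub_right_injective.injOn) u
  filter_upwards [Ioo_mem_nhds ht.1 ht.2] with τ hτ
    using ⟨by linarith [hτ.2], by linarith [hτ.1]⟩

theorem hasDerivAt_smoothTransition (x : ℝ) :
    HasDerivAt Real.smoothTransition (deriv Real.smoothTransition x) x :=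
  ((Real.smoothTransition.contDiff (n := 1)).differentiable (by simp)).differentiableAt.hasDerivAt

/-- The half of a concatenation which runs through `γ₁` on the interval `(b, b + 1/2)`, with a
smooth stop at both ends, has the length of `γ₁`. -/
theorem lintegral_speed_smoothTransition {a : ℝ → ℝ} {γ γ₁ : ℝ → ℝ × H}
    (hγ₁ : ContDiffOn ℝ 1 γ₁ (Icc 0 1)) {b : ℝ} (hb : 0 ≤ b) (hb' : b + 1 / 2 ≤ 1)
    (hev : ∀ t ∈ Ioo b (b + 1 / 2), γ t = γ₁ (Real.smoothTransition (2 * (t - b)))) :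
    ∫⁻ t in Icc b (b + 1 / 2), ENNReal.ofReal (speed a γ t) = length a γ₁ := by
  rw [← setLIntegral_congr (Ioo_ae_eq_Icc (μ := volume) (a := b) (b := b + 1 / 2))]
  set h : ℝ → ℝ := fun t => Real.smoothTransition (2 * (t - b)) with hh
  set k : ℝ → ℝ := fun t => deriv Real.smoothTransition (2 * (t - b)) * 2 with hkdef
  have hd : ∀ t, HasDerivAt h (k t) t := fun t =>
    (hasDerivAt_smoothTransition _).comp t
      (((hasDerivAt_id t).sub_const b).const_mul 2 |>.congr_deriv (mul_one 2))
  have hmono : Monotone h := fun x y hxy =>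
    Real.smoothTransition.monotone (by linarith)
  have hk0 : ∀ t, 0 ≤ k t := fun t =>
    mul_nonneg Real.smoothTransition.monotone.deriv_nonneg two_pos.le
  have himg : h '' Ioo b (b + 1 / 2) = Ioo 0 1 := by
    apply Subset.antisymm
    · rintro _ ⟨t, ht, rfl⟩
      exact ⟨Real.smoothTransition.pos_of_pos (by linarith [ht.1]),
        Real.smoothTransition.lt_one_of_lt_one (by linarith [ht.2])⟩
    · have h0 : h b = 0 := Real.smoothTransition.zero_of_nonpos (by linarith)
      have h1 : h (b + 1 / 2) = 1 := Real.smoothTransition.one_of_one_le (by linarith)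
      have := intermediate_value_Ioo (f := h) (show b ≤ b + 1 / 2 by linarith)
        (fun t _ => (hd t).continuousAt.continuousWithinAt)
      rwa [h0, h1] at this
  refine lintegral_speed_comp (h := h) (k := k) hγ₁
    (Ioo_subset_Ioo hb hb') measurableSet_Ioo (fun t ht => ?_)
    (fun t _ => Eventually.of_forall fun τ => ⟨Real.smoothTransition.nonneg _,
      Real.smoothTransition.le_one _⟩) (fun t _ => hd t) himg fun u => ?_
  · filter_upwards [Ioo_mem_nhds ht.1 ht.2] with τ hτ using hev τ hτ
  · rw [lintegral_image_eq_lintegral_deriv_mul_of_monotoneOn measurableSet_Ioo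
      (fun t _ => (hd t).hasDerivWithinAt) (hmono.monotoneOn _) u]
    simp only [abs_of_nonneg (hk0 _)]

/-- A lower bound for the length of a curve: the distance covered by a component `f` of the curve
whose velocity `f'` is bounded by the speed. -/
theorem ofReal_norm_sub_le_length {E : Type*} [NormedAddCommGroup E] [NormedSpace ℝ E]
    [CompleteSpace E] {a : ℝ → ℝ} {γ : ℝ → ℝ × H} {f f' : ℝ → E}
    (hf : ∀ t ∈ Icc (0 : ℝ) 1, HasDerivWithinAt f (f' t) (Icc 0 1) t)
    (hf' : ContinuousOn f' (Icc 0 1)) (hle : ∀ t ∈ Icc (0 : ℝ) 1, ‖f' t‖ ≤ speed a γ t)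
    {t : ℝ} (ht : t ∈ Icc (0 : ℝ) 1) : ENNReal.ofReal ‖f t - f 0‖ ≤ length a γ := by
  have hsub : Icc 0 t ⊆ Icc (0 : ℝ) 1 := Icc_subset_Icc le_rfl ht.2
  have hFTC : ∫ τ in (0 : ℝ)..t, f' τ = f t - f 0 :=
    intervalIntegral.integral_eq_sub_of_hasDerivAt_of_le ht.1
      (fun τ hτ => (hf τ (hsub hτ)).continuousWithinAt.mono hsub)
      (fun τ hτ => (hf τ (hsub (Ioo_subset_Icc_self hτ))).hasDerivAt
        (Icc_mem_nhds hτ.1 (hτ.2.trans_le ht.2)))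
      ((hf'.mono (by rwa [uIcc_of_le ht.1])).intervalIntegrable)
  rw [← hFTC, intervalIntegral.integral_of_le ht.1, ofReal_norm]
  calc _ ≤ ∫⁻ τ in Ioc 0 t, ‖f' τ‖ₑ := enorm_integral_le_lintegral_enorm _
    _ ≤ ∫⁻ τ in Icc (0 : ℝ) 1, ‖f' τ‖ₑ := lintegral_mono_set (Ioc_subset_Icc_self.trans hsub)
    _ ≤ length a γ := setLIntegral_mono' measurableSet_Icc fun τ hτ => by
      rw [← ofReal_norm]
      exact ENNReal.ofReal_le_ofReal (hle τ hτ)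

theorem hasDerivWithinAt_fst_snd {γ : ℝ → ℝ × H} (hγ : ContDiffOn ℝ 1 γ (Icc 0 1)) {t : ℝ}
    (ht : t ∈ Icc (0 : ℝ) 1) :
    HasDerivWithinAt (fun t => (γ t).1) (derivWithin γ (Icc 0 1) t).1 (Icc 0 1) t ∧
      HasDerivWithinAt (fun t => (γ t).2) (derivWithin γ (Icc 0 1) t).2 (Icc 0 1) t := by
  have h := ((hγ.differentiableOn (by simp)) t ht).hasDerivWithinAt
  exact ⟨(hasFDerivAt_fst (𝕜 := ℝ) (p := γ t)).comp_hasDerivWithinAt t h,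
    (hasFDerivAt_snd (𝕜 := ℝ) (p := γ t)).comp_hasDerivWithinAt t h⟩

theorem continuousOn_derivWithin_Icc {γ : ℝ → ℝ × H} (hγ : ContDiffOn ℝ 1 γ (Icc 0 1)) :
    ContinuousOn (derivWithin γ (Icc 0 1)) (Icc 0 1) :=
  hγ.continuousOn_derivWithin (uniqueDiffOn_Icc zero_lt_one) le_rfl

theorem ofReal_abs_fst_sub_le_length {a : ℝ → ℝ} (hpos : ∀ x, 0 < a x) {γ : ℝ → ℝ × H}
    (hγ : ContDiffOn ℝ 1 γ (Icc 0 1)) {t : ℝ} (ht : t ∈ Icc (0 : ℝ) 1) :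
    ENNReal.ofReal |(γ t).1 - (γ 0).1| ≤ length a γ :=
  ofReal_norm_sub_le_length (fun _ hτ => (hasDerivWithinAt_fst_snd hγ hτ).1)
    (continuousOn_derivWithin_Icc hγ).fst (fun τ _ => Real.abs_le_sqrt (by
      rw [metric_self]
      exact le_add_of_nonneg_right (mul_nonneg (hpos _).le (sq_nonneg _)))) ht

theorem ofReal_mul_norm_snd_sub_le_length [CompleteSpace H] {a : ℝ → ℝ} {γ : ℝ → ℝ × H}
    (hγ : ContDiffOn ℝ 1 γ (Icc 0 1)) {c : ℝ} (hc : 0 ≤ c)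
    (hca : ∀ t ∈ Icc (0 : ℝ) 1, c ^ 2 ≤ a (γ t).1) :
    ENNReal.ofReal (c * ‖(γ 1).2 - (γ 0).2‖) ≤ length a γ := by
  have h := ofReal_norm_sub_le_length (a := a) (γ := γ) (f := fun t => c • (γ t).2)
    (f' := fun t => c • (derivWithin γ (Icc 0 1) t).2)
    (fun _ hτ => (hasDerivWithinAt_fst_snd hγ hτ).2.const_smul c)
    ((continuousOn_derivWithin_Icc hγ).snd.const_smul c) (fun τ hτ => by
      rw [norm_smul, Real.norm_of_nonneg hc]
      refine Real.le_sqrt_of_sq_le ?_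
      rw [metric_self, mul_pow]
      exact le_add_of_nonneg_of_le (sq_nonneg _)
        (mul_le_mul_of_nonneg_right (hca τ hτ) (sq_nonneg _))) (right_mem_Icc.2 zero_le_one)
  simpa only [← smul_sub, norm_smul, Real.norm_of_nonneg hc] using h

end Length

/-! ### The geodesic distance -/

theorem mem_cylinder_sphere {H : Type*} [NormedAddCommGroup H] (r : ℝ)
    (φ : Metric.sphere (0 : H) 1) : (r, (φ : H)) ∈ cylinder H :=
  ⟨mem_univ _, φ.2⟩

section GeodesicDistance

variable {H : Type*} [NormedAddCommGroup H] [InnerProductSpace ℝ H]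

theorem geodesicDist_le_length {a : ℝ → ℝ} {x y : ℝ × Metric.sphere (0 : H) 1} {γ : ℝ → ℝ × H}
    (hγ : ContDiffOn ℝ 1 γ (Icc 0 1)) (hcyl : ∀ t ∈ Icc (0 : ℝ) 1, γ t ∈ cylinder H)
    (h0 : γ 0 = (x.1, (x.2 : H))) (h1 : γ 1 = (y.1, (y.2 : H))) :
    geodesicDist a x y ≤ length a γ :=
  iInf_le_of_le γ <| iInf_le_of_le hγ <| iInf_le_of_le hcyl <| iInf_le_of_le h0 <|
    iInf_le_of_le h1 le_rfl

theorem exists_length_lt {a : ℝ → ℝ} {x y : ℝ × Metric.sphere (0 : H) 1} {r : ℝ≥0∞}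
    (h : geodesicDist a x y < r) : ∃ γ : ℝ → ℝ × H, ContDiffOn ℝ 1 γ (Icc 0 1) ∧
      (∀ t ∈ Icc (0 : ℝ) 1, γ t ∈ cylinder H) ∧ γ 0 = (x.1, (x.2 : H)) ∧
      γ 1 = (y.1, (y.2 : H)) ∧ length a γ < r := by
  simp only [geodesicDist, iInf_lt_iff] at h
  obtain ⟨γ, h1, h2, h3, h4, h5⟩ := h
  exact ⟨γ, h1, h2, h3, h4, h5⟩

theorem geodesicDist_self (a : ℝ → ℝ) (x : ℝ × Metric.sphere (0 : H) 1) :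
    geodesicDist a x x = 0 := by
  refine le_antisymm ((geodesicDist_le_length (γ := fun _ => (x.1, (x.2 : H))) contDiffOn_const
    (fun _ _ => mem_cylinder_sphere _ _) rfl rfl).trans ?_) zero_le
  simp [length, metric]

theorem geodesicDist_comm_le (a : ℝ → ℝ) (x y : ℝ × Metric.sphere (0 : H) 1) :
    geodesicDist a y x ≤ geodesicDist a x y := by
  refine le_of_forall_gt fun r hr => ?_
  obtain ⟨γ, h1, h2, h3, h4, h5⟩ := exists_length_lt hr
  have hmaps : MapsTo (fun t : ℝ => 1 - t) (Icc 0 1) (Icc 0 1) := fun t ht =>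
    ⟨by linarith [ht.2], by linarith [ht.1]⟩
  rw [← length_reverse h1] at h5
  exact (geodesicDist_le_length (h1.comp (contDiff_const.sub contDiff_id).contDiffOn hmaps)
    (fun t ht => h2 _ (hmaps ht)) (by simp [h4]) (by simp [h3])).trans_lt h5

/-- The triangle inequality. Two `C¹` curves are concatenated to a `C¹` curve by reparametrising
them with `Real.smoothTransition`, so that they stop smoothly at the common end point `p`; in the
ambient linear space the concatenation is `γ₁(h₁(t)) + γ₂(h₂(t)) - p`. -/
theorem geodesicDist_triangle (a : ℝ → ℝ) (x y z : ℝ × Metric.sphere (0 : H) 1) :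
    geodesicDist a x z ≤ geodesicDist a x y + geodesicDist a y z := by
  refine ENNReal.le_of_forall_pos_le_add fun ε hε hfin => ?_
  have hε2 : (ε / 2 : NNReal) ≠ 0 := (half_pos hε).ne'
  have hε2' : ((ε / 2 : NNReal) : ℝ≥0∞) ≠ 0 := by simpa using hε2
  rw [ENNReal.add_lt_top] at hfin
  obtain ⟨γ₁, hγ₁, hc₁, h10, h11, hl₁⟩ := exists_length_lt (ENNReal.lt_add_right hfin.1.ne hε2')
  obtain ⟨γ₂, hγ₂, hc₂, h20, h21, hl₂⟩ := exists_length_lt (ENNReal.lt_add_right hfin.2.ne hε2')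
  set h₁ : ℝ → ℝ := fun t => Real.smoothTransition (2 * (t - 0)) with hh₁
  set h₂ : ℝ → ℝ := fun t => Real.smoothTransition (2 * (t - 1 / 2)) with hh₂
  have hmem : ∀ x, Real.smoothTransition x ∈ Icc (0 : ℝ) 1 := fun x =>
    ⟨Real.smoothTransition.nonneg _, Real.smoothTransition.le_one _⟩
  have hC : ∀ b : ℝ, ContDiff ℝ 1 fun t : ℝ => Real.smoothTransition (2 * (t - b)) := fun b =>
    (Real.smoothTransition.contDiff (n := 1)).comp
      (contDiff_const.mul (contDiff_id.sub contDiff_const))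
  set p : ℝ × H := (y.1, (y.2 : H)) with hp
  set γ : ℝ → ℝ × H := fun t => γ₁ (h₁ t) + γ₂ (h₂ t) - p with hγdef
  have hleft : ∀ t ≤ 1 / 2, γ t = γ₁ (h₁ t) := fun t ht => by
    have : h₂ t = 0 := Real.smoothTransition.zero_of_nonpos (by linarith)
    simp only [hγdef, this, h20, add_sub_cancel_right]
  have hright : ∀ t ≥ 1 / 2, γ t = γ₂ (h₂ t) := fun t ht => by
    have : h₁ t = 1 := Real.smoothTransition.one_of_one_le (by linarith)
    simp only [hγdef, this, h11, add_sub_cancel_left]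
  have hγC : ContDiffOn ℝ 1 γ (Icc 0 1) :=
    ((hγ₁.comp (hC 0).contDiffOn fun _ _ => hmem _).add
      (hγ₂.comp (hC (1 / 2)).contDiffOn fun _ _ => hmem _)).sub contDiffOn_const
  have hcyl : ∀ t ∈ Icc (0 : ℝ) 1, γ t ∈ cylinder H := fun t _ => by
    rcases le_total t (1 / 2) with h | h
    · exact hleft t h ▸ hc₁ _ (hmem _)
    · exact hright t h ▸ hc₂ _ (hmem _)
  have h0 : γ 0 = (x.1, (x.2 : H)) := by
    rw [hleft 0 (by norm_num), ← h10]
    exact congrArg γ₁ (Real.smoothTransition.zero_of_nonpos (by norm_num))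
  have h1 : γ 1 = (z.1, (z.2 : H)) := by
    rw [hright 1 (by norm_num), ← h21]
    exact congrArg γ₂ (Real.smoothTransition.one_of_one_le (by norm_num))
  have hlen : length a γ ≤ length a γ₁ + length a γ₂ := by
    have e1 := lintegral_speed_smoothTransition (a := a) (γ := γ) hγ₁ (b := 0) le_rfl (by norm_num)
      fun t ht => hleft t (by linarith [ht.2])
    have e2 := lintegral_speed_smoothTransition (a := a) (γ := γ) hγ₂ (b := 1 / 2) (by norm_num)
      (by norm_num) fun t ht => hright t ht.1.le
    rw [← e1, ← e2, zero_add, add_halves]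
    calc length a γ
        ≤ ∫⁻ t in Icc (0 : ℝ) (1 / 2) ∪ Icc (1 / 2) 1, ENNReal.ofReal (speed a γ t) := by
          rw [Icc_union_Icc_eq_Icc (by norm_num) (by norm_num)]
          exact le_rfl
      _ ≤ _ := lintegral_union_le _ _ _
  calc geodesicDist a x z ≤ length a γ := geodesicDist_le_length hγC hcyl h0 h1
    _ ≤ length a γ₁ + length a γ₂ := hlen
    _ ≤ (geodesicDist a x y + (ε / 2 : NNReal)) + (geodesicDist a y z + (ε / 2 : NNReal)) :=
      add_le_add hl₁.le hl₂.le
    _ = geodesicDist a x y + geodesicDist a y z + ε := by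
      rw [add_add_add_comm, ← ENNReal.coe_add, add_halves]

theorem ofReal_abs_sub_le_geodesicDist {a : ℝ → ℝ} (hpos : ∀ x, 0 < a x)
    (x y : ℝ × Metric.sphere (0 : H) 1) :
    ENNReal.ofReal |x.1 - y.1| ≤ geodesicDist a x y := by
  refine le_of_forall_gt fun r hr => ?_
  obtain ⟨γ, h1, h2, h3, h4, h5⟩ := exists_length_lt hr
  have h := ofReal_abs_fst_sub_le_length hpos h1 (right_mem_Icc.2 zero_le_one)
  rw [h3, h4, abs_sub_comm] at h
  exact h.trans_lt h5

/-- Near a point, the geodesic distance controls the chordal distance on the sphere: short curves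
stay where the warping function is bounded below. -/
theorem ofReal_mul_norm_sub_le_geodesicDist [CompleteSpace H] {a : ℝ → ℝ} (hpos : ∀ x, 0 < a x)
    {x y : ℝ × Metric.sphere (0 : H) 1} {c R : ℝ} (hc : 0 ≤ c)
    (hca : ∀ r ∈ Icc (x.1 - R) (x.1 + R), c ^ 2 ≤ a r)
    (hR : geodesicDist a x y < ENNReal.ofReal R) :
    ENNReal.ofReal (c * ‖(x.2 : H) - y.2‖) ≤ geodesicDist a x y := by
  by_contra! hlt
  obtain ⟨γ, h1, h2, h3, h4, h5⟩ := exists_length_lt (lt_min hR hlt)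
  have h := ofReal_mul_norm_snd_sub_le_length (a := a) h1 hc fun t ht => hca _ (by
    have h6 := (ofReal_abs_fst_sub_le_length hpos h1 ht).trans_lt
      (h5.trans_le (min_le_left _ _))
    rw [h3] at h6
    have h7 := abs_lt.1 (ENNReal.ofReal_lt_ofReal_iff'.1 h6).1
    exact ⟨by linarith [h7.1], by linarith [h7.2]⟩)
  rw [h3, h4, norm_sub_rev] at h
  exact (h.trans_lt (h5.trans_le (min_le_right _ _))).false

/-- An upper bound for the geodesic distance of nearby points, by the length of the curve that is
linear in `s` and the normalised chord in the sphere. -/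
theorem geodesicDist_le {a : ℝ → ℝ} {x y : ℝ × Metric.sphere (0 : H) 1} {A : ℝ} (hA : 0 ≤ A)
    (haA : ∀ r ∈ uIcc x.1 y.1, a r ≤ A ^ 2) (hxy : ‖(y.2 : H) - x.2‖ ≤ 1 / 2) :
    geodesicDist a x y ≤ ENNReal.ofReal (|y.1 - x.1| + A * (4 * ‖(y.2 : H) - x.2‖)) := by
  set Δ : H := (y.2 : H) - x.2 with hΔ
  have hx1 : ‖(x.2 : H)‖ = 1 := norm_eq_of_mem_sphere x.2
  have hy1 : ‖(y.2 : H)‖ = 1 := norm_eq_of_mem_sphere y.2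
  set w : ℝ → H := fun t => (x.2 : H) + t • Δ with hw
  have hwC : ContDiff ℝ 1 w := contDiff_const.add (contDiff_id.smul contDiff_const)
  have hwd : ∀ t, HasDerivAt w Δ t := fun t => by
    exact (((hasDerivAt_id t).smul_const Δ).const_add (x.2 : H)).congr_deriv (one_smul ℝ Δ)
  have hw2 : ∀ t ∈ Icc (0 : ℝ) 1, 1 / 2 ≤ ‖w t‖ := fun t ht => by
    have h1 : ‖t • Δ‖ ≤ 1 / 2 := by
      rw [norm_smul, Real.norm_of_nonneg ht.1]
      exact (mul_le_of_le_one_left (norm_nonneg _) ht.2).trans hxy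
    have h2 := norm_sub_norm_le (x.2 : H) (-(t • Δ))
    rw [norm_neg, sub_neg_eq_add, hx1] at h2
    linarith
  have hwne : ∀ t ∈ Icc (0 : ℝ) 1, w t ≠ 0 := fun t ht h => by
    have := hw2 t ht
    rw [h, norm_zero] at this
    norm_num at this
  set γ : ℝ → ℝ × H := fun t => (x.1 + t * (y.1 - x.1), ‖w t‖⁻¹ • w t) with hγ
  have hγC : ContDiffOn ℝ 1 γ (Icc 0 1) :=
    (contDiff_const.add (contDiff_id.mul contDiff_const)).contDiffOn.prodMk
      (((hwC.contDiffOn.norm ℝ hwne).inv fun t ht => norm_ne_zero_iff.2 (hwne t ht)).smul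
        hwC.contDiffOn)
  have hcyl : ∀ t ∈ Icc (0 : ℝ) 1, γ t ∈ cylinder H := fun t ht => mem_cylinder (by
    simp only [hγ]
    rw [norm_smul, norm_inv, norm_norm, inv_mul_cancel₀ (norm_ne_zero_iff.2 (hwne t ht))])
  -- the derivative of the normalised chord
  have hγd : ∀ t ∈ Icc (0 : ℝ) 1, ∃ e : H, ‖e‖ ≤ 4 * ‖Δ‖ ∧ HasDerivAt γ (y.1 - x.1, e) t := by
    intro t ht
    have hwpos : 0 < ‖w t‖ := norm_pos_iff.2 (hwne t ht)
    have hn : HasDerivAt (fun τ => ‖w τ‖) (inner ℝ (w t) Δ / ‖w t‖) t := by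
      have h1 := ((hwd t).norm_sq).sqrt (pow_pos hwpos 2).ne'
      simp only [Real.sqrt_sq (norm_nonneg _)] at h1
      refine h1.congr_deriv ?_
      field_simp
    have hd := (hn.fun_inv hwpos.ne').smul (hwd t)
    refine ⟨_, ?_, (((hasDerivAt_id t).mul_const (y.1 - x.1)).const_add x.1 |>.congr_deriv
      (one_mul _)).prodMk hd⟩
    have hinner : |inner ℝ (w t) Δ| ≤ ‖w t‖ * ‖Δ‖ := abs_real_inner_le_norm _ _
    have hinv : ‖w t‖⁻¹ ≤ 2 := by
      rw [inv_le_comm₀ hwpos two_pos]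
      linarith [hw2 t ht]
    refine (norm_add_le _ _).trans ?_
    have e1 : ‖(‖w t‖)⁻¹ • Δ‖ ≤ 2 * ‖Δ‖ := by
      rw [norm_smul, norm_inv, norm_norm]
      exact mul_le_mul_of_nonneg_right hinv (norm_nonneg _)
    have e2 : ‖(-(inner ℝ (w t) Δ / ‖w t‖) / ‖w t‖ ^ 2) • w t‖ ≤ 2 * ‖Δ‖ := by
      rw [norm_smul, norm_div, norm_neg, norm_div, norm_pow, norm_norm, Real.norm_eq_abs]
      calc |inner ℝ (w t) Δ| / ‖w t‖ / ‖w t‖ ^ 2 * ‖w t‖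
          ≤ ‖w t‖ * ‖Δ‖ / ‖w t‖ / ‖w t‖ ^ 2 * ‖w t‖ := by gcongr
        _ = ‖w t‖⁻¹ * ‖Δ‖ := by field_simp
        _ ≤ 2 * ‖Δ‖ := mul_le_mul_of_nonneg_right hinv (norm_nonneg _)
    linarith
  refine (geodesicDist_le_length hγC hcyl ?_ ?_).trans ?_
  · simp [hγ, hw, hx1]
  · simp [hγ, hw, hΔ, hy1]
  · have hspeed : ∀ t ∈ Icc (0 : ℝ) 1, speed a γ t ≤ |y.1 - x.1| + A * (4 * ‖Δ‖) := by
      intro t ht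
      obtain ⟨e, he, hd⟩ := hγd t ht
      have hnn : 0 ≤ A * (4 * ‖Δ‖) := by positivity
      rw [speed, hd.hasDerivWithinAt.derivWithin (uniqueDiffOn_Icc zero_lt_one t ht), metric_self]
      refine Real.sqrt_le_iff.2 ⟨by positivity, ?_⟩
      have h1 : a (γ t).1 ≤ A ^ 2 := haA _ (by
        have hseg : x.1 + t * (y.1 - x.1) ∈ segment ℝ x.1 y.1 :=
          ⟨1 - t, t, by linarith [ht.2], ht.1, by ring, by simp only [smul_eq_mul]; ring⟩
        rwa [segment_eq_uIcc] at hseg)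
      have h2 : a (γ t).1 * ‖e‖ ^ 2 ≤ (A * (4 * ‖Δ‖)) ^ 2 := by
        rw [mul_pow]
        exact mul_le_mul h1 (pow_le_pow_left₀ (norm_nonneg _) he 2) (sq_nonneg _) (sq_nonneg _)
      calc (y.1 - x.1) ^ 2 + a (γ t).1 * ‖e‖ ^ 2 ≤ |y.1 - x.1| ^ 2 + (A * (4 * ‖Δ‖)) ^ 2 := by
            rw [sq_abs]
            exact add_le_add_right h2 _
        _ ≤ _ := by
          rw [add_sq]
          have := mul_nonneg (mul_nonneg two_pos.le (abs_nonneg (y.1 - x.1))) hnn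
          linarith
    calc length a γ ≤ ∫⁻ _ in Icc (0 : ℝ) 1, ENNReal.ofReal (|y.1 - x.1| + A * (4 * ‖Δ‖)) :=
          setLIntegral_mono' measurableSet_Icc fun t ht => ENNReal.ofReal_le_ofReal (hspeed t ht)
      _ = _ := by simp

/-- An extended metric is complete if its Cauchy sequences converge. -/
theorem isMetricallyComplete_of_cauchySeq {X : Type*} {d : X → X → ℝ≥0∞} (h0 : ∀ x, d x x = 0)
    (hcomm : ∀ x y, d x y = d y x) (htri : ∀ x y z, d x z ≤ d x y + d y z)
    (heq : ∀ x y, d x y = 0 → x = y)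
    (hlim : ∀ u : ℕ → X, (∀ ε > 0, ∃ N, ∀ m, N ≤ m → ∀ n, N ≤ n → d (u m) (u n) < ε) →
      ∃ x, Tendsto (fun n => d (u n) x) atTop (𝓝 0)) : IsMetricallyComplete d := by
  let pe : PseudoEMetricSpace X :=
    { edist := d, edist_self := h0, edist_comm := hcomm, edist_triangle := htri }
  let e : EMetricSpace X := { pe with eq_of_edist_eq_zero := fun {x y} h => heq x y h }
  refine ⟨e, fun _ _ => rfl, EMetric.complete_of_cauchySeq_tendsto fun u hu => ?_⟩
  obtain ⟨x, hx⟩ := hlim u (EMetric.cauchySeq_iff.1 hu)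
  exact ⟨x, tendsto_iff_edist_tendsto_0.2 hx⟩

/-- The warped cylinder over the unit sphere of a Hilbert space is metrically complete. -/
theorem isMetricallyComplete_geodesicDist [CompleteSpace H] {a : ℝ → ℝ} (ha : Continuous a)
    (hpos : ∀ x, 0 < a x) : IsMetricallyComplete (geodesicDist (H := H) a) := by
  have hlower : ∀ p q : ℝ, ∃ c > 0, ∀ r ∈ Icc p q, c ^ 2 ≤ a r := fun p q => by
    obtain ⟨c, hc, hca⟩ := isCompact_Icc.exists_forall_le' (s := Icc p q) ha.continuousOn (a := 0)
      fun r _ => hpos r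
    refine ⟨Real.sqrt c, Real.sqrt_pos.2 hc, fun r hr => ?_⟩
    rw [Real.sq_sqrt hc.le]
    exact hca r hr
  refine isMetricallyComplete_of_cauchySeq (geodesicDist_self a)
    (fun x y => le_antisymm (geodesicDist_comm_le a y x) (geodesicDist_comm_le a x y))
    (geodesicDist_triangle a) (fun x y hxy => ?_) fun u hu => ?_
  · obtain ⟨c, hc, hca⟩ := hlower (x.1 - 1) (x.1 + 1)
    have h1 := ofReal_abs_sub_le_geodesicDist hpos x y
    have h2 := ofReal_mul_norm_sub_le_geodesicDist hpos (x := x) (y := y) hc.le hca (by simp [hxy])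
    rw [hxy, nonpos_iff_eq_zero, ENNReal.ofReal_eq_zero] at h1 h2
    have h3 : ‖(x.2 : H) - y.2‖ ≤ 0 := by
      by_contra! h
      exact (mul_pos hc h).not_ge h2
    exact Prod.ext (sub_eq_zero.1 (abs_nonpos_iff.1 h1))
      (Subtype.ext (sub_eq_zero.1 (norm_le_zero_iff.1 h3)))
  · have hs : CauchySeq fun n => (u n).1 := by
      refine Metric.cauchySeq_iff.2 fun ε hε => ?_
      obtain ⟨N, hN⟩ := hu (ENNReal.ofReal ε) (ENNReal.ofReal_pos.2 hε)
      exact ⟨N, fun m hm n hn => (ENNReal.ofReal_lt_ofReal_iff hε).1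
        ((ofReal_abs_sub_le_geodesicDist hpos _ _).trans_lt (hN m hm n hn))⟩
    obtain ⟨s, hs⟩ := cauchySeq_tendsto_of_complete hs
    obtain ⟨N₀, hN₀⟩ := Metric.tendsto_atTop.1 hs 1 one_pos
    obtain ⟨c, hc, hca⟩ := hlower (s - 2) (s + 2)
    have hφ : CauchySeq fun n => ((u n).2 : H) := by
      refine Metric.cauchySeq_iff.2 fun ε hε => ?_
      obtain ⟨N, hN⟩ := hu (ENNReal.ofReal (min 1 (c * ε)))
        (ENNReal.ofReal_pos.2 (lt_min one_pos (mul_pos hc hε)))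
      refine ⟨max N₀ N, fun m hm n hn => ?_⟩
      have hd := hN m (le_of_max_le_right hm) n (le_of_max_le_right hn)
      have hm1 := abs_lt.1 (Real.dist_eq _ _ ▸ hN₀ m (le_of_max_le_left hm))
      have h := ofReal_mul_norm_sub_le_geodesicDist hpos (R := 1) hc.le
        (fun r hr => hca r ⟨by linarith [hr.1, hm1.1], by linarith [hr.2, hm1.2]⟩)
        (hd.trans_le (ENNReal.ofReal_le_ofReal (min_le_left _ _)))
      have h' := (ENNReal.ofReal_lt_ofReal_iff'.1 (h.trans_lt hd)).1.trans_le (min_le_right _ _)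
      rw [dist_eq_norm]
      exact lt_of_mul_lt_mul_left h' hc.le
    obtain ⟨φ, hφ⟩ := cauchySeq_tendsto_of_complete hφ
    have hφ1 : φ ∈ Metric.sphere (0 : H) 1 :=
      Metric.isClosed_sphere.mem_of_tendsto hφ (Eventually.of_forall fun n => (u n).2.2)
    obtain ⟨A, hA⟩ := isCompact_Icc.exists_bound_of_continuousOn
      (ha.continuousOn (s := Icc (s - 1) (s + 1)))
    have hA0 : 0 ≤ A := (norm_nonneg _).trans (hA s ⟨by linarith, by linarith⟩)
    refine ⟨(s, ⟨φ, hφ1⟩), ?_⟩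
    have hbound : Tendsto (fun n => ENNReal.ofReal
        (|s - (u n).1| + Real.sqrt A * (4 * ‖φ - (u n).2‖))) atTop (𝓝 0) := by
      have h1 : Tendsto (fun n => |s - (u n).1| + Real.sqrt A * (4 * ‖φ - (u n).2‖)) atTop
          (𝓝 (|s - s| + Real.sqrt A * (4 * ‖φ - φ‖))) :=
        (tendsto_const_nhds.sub hs).abs.add
          (((tendsto_const_nhds.sub hφ).norm.const_mul 4).const_mul _)
      simpa using ENNReal.tendsto_ofReal h1
    refine tendsto_of_tendsto_of_tendsto_of_le_of_le' tendsto_const_nhds hbound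
      (Eventually.of_forall fun _ => zero_le) ?_
    obtain ⟨N₁, hN₁⟩ := Metric.tendsto_atTop.1 hφ (1 / 2) (by norm_num)
    filter_upwards [eventually_ge_atTop N₀, eventually_ge_atTop N₁] with n hn0 hn1
    refine geodesicDist_le (Real.sqrt_nonneg A) (fun r hr => ?_) ?_
    · rw [Real.sq_sqrt hA0]
      have hn := abs_lt.1 (Real.dist_eq _ _ ▸ hN₀ n hn0)
      have hr' : r ∈ Icc (s - 1) (s + 1) := by
        refine (uIcc_subset_Icc ⟨?_, ?_⟩ ⟨?_, ?_⟩) hr <;> linarith [hn.1, hn.2]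
      exact (le_abs_self _).trans (hA r hr')
    · have := hN₁ n hn1
      rw [dist_eq_norm, norm_sub_rev] at this
      exact this.le

end GeodesicDistance

end FisherRao

end

theorem mainTheorem1 {m : ℕ} {B : Type*} [TopologicalSpace B]
    (I : ModelWithCorners ℝ (EuclideanSpace ℝ (Fin m)) B)
    {M : Type*} [TopologicalSpace M] [ChartedSpace B M] [IsManifold I ∞ M]
    [CompactSpace M] [T2Space M] [MeasurableSpace M] [BorelSpace M]
    (μ₀ : Measure M) [IsProbabilityMeasure μ₀]
    (hμ₀ : FisherRao.IsSmoothPositiveDensity I μ₀)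
    (C₁ C₂ : ℝ → ℝ)
    (hC₁ : ContDiffOn ℝ ∞ C₁ (Ioi 0)) (hC₂ : ContDiffOn ℝ ∞ C₂ (Ioi 0))
    (hpos₁ : ∀ x > 0, 0 < C₁ x) (hpos₂ : ∀ x > 0, -(1 / x) * C₁ x < C₂ x)
    (hW_minus : Tendsto (FisherRao.W C₁ C₂) (𝓝[>] 0) atBot)
    (hW_plus : Tendsto (FisherRao.W C₁ C₂) atTop atTop) :
    FisherRao.IsMetricallyComplete
      (FisherRao.geodesicDist (H := Lp ℝ 2 μ₀) (FisherRao.warp C₁ C₂)) ∧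
    FisherRao.IsGeodesicallyComplete (FisherRao.warp C₁ C₂)
      (FisherRao.fullSpace (Lp ℝ 2 μ₀)) ∧
    FisherRao.IsGeodesicallyComplete (FisherRao.warp C₁ C₂)
      (FisherRao.smoothFunctions I μ₀) := by
  have hsurj := FisherRao.surjOn_W hC₁ hC₂ hpos₂ hW_minus hW_plus
  have ha := FisherRao.contDiff_warp hC₁ hC₂ hpos₂ hsurj
  have hpos := FisherRao.warp_pos hpos₁ hsurj
  exact ⟨FisherRao.isMetricallyComplete_geodesicDist ha.continuous hpos,
    FisherRao.isGeodesicallyComplete (FisherRao.isRegular_fullSpace _) ha hpos,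
    FisherRao.isGeodesicallyComplete (FisherRao.isRegular_smoothFunctions I μ₀) ha hpos⟩
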